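/- Let $\mathcal M$ be a model category and let $\mathcal W$ be its class of weak equivalences. **Mapping spaces.** For objects $X,Y$ of $\mathcal M$ and $n$ odd, let $\mathcal L^H_n\mathcal M(X,Y)$ be the category whose objects are the zigzags $$X=C_0\xleftarrow{d_0}C_1\xrightarrow{d_1}C_2\leftarrow\cdots\to C_{n-1}\xleftarrow{d_{n-1}}C_n=Y$$ whose arrows pointing to the left are in $\mathcal W$, and whose morphisms are the commutative ladders between such zigzags which are identities at $X$ and at $Y$. A $k$-simplex of the nerve $N\mathcal L^H_n\mathcal M(X,Y)$ is thus a diagram with $k+1$ rows and $n$ columns of horizontal arrows (a hammock of width $k$ and length $n$). Let $\mathrm{map}(X,Y)=\mathcal L^H\mathcal M(X,Y)$ be the hammock localization mapping space, that is, the simplicial set obtained from $\coprod_{n\text{ odd}}N\mathcal L^H_n\mathcal M(X,Y)$ by identifying two hammocks whenever one is obtained from the other by omitting a column of horizontal arrows which consists of identities only and is neither the first nor the last column, and composing its two neighbouring columns. (In particular, inserting two consecutive columns of identities does not change a simplex.) A morphism $f\colon A\to B$ induces $f^*\colon \mathrm{map}(B,X)\to\mathrm{map}(A,X)$, by adding the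 columns $A\xleftarrow{\mathrm{id}}A\xrightarrow{f}B$ on the left of a hammock. We say that $f$ and $X$ are *simplicially orthogonal* if $f^*$ is a weak homotopy equivalence of simplicial sets. **Homotopy idempotent functors.** Let $L\colon\mathcal M\to\mathcal M$ be a functor and $\ell\colon 1\to L$ a natural transformation such that $(L,\ell)$ is homotopy idempotent, i.e., $L$ sends weak equivalences to weak equivalences and, for every object $X$, the morphisms $\ell_{LX},L\ell_X\colon LX\to LLX$ are equal in the homotopy category $\mathrm{Ho}(\mathcal M)$ and are both weak equivalences. A morphism $f$ is an *$L$-equivalence* if $Lf$ is a weak equivalence. A fibrant object $X$ is *$L$-local* if it is weakly equivalent (through a zigzag of weak equivalences) to $LY$ for some object $Y$. **Proposition.** The following hold. 1. A morphism of $\mathcal M$ is an $L$-equivalence if and only if it is simplicially orthogonal to every $L$-local object. 2. A fibrant object of $\mathcal M$ is $L$-local if and only if it is simplicially orthogonal to every $L$-equivalence. -/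

import Mathlib

open CategoryTheory HomotopicalAlgebra Opposite MonoidalCategory

universe w v u v' u'

/-! ### Zigzags and hammocks -/

/-- `OddZigzag W Y X` is the type of zigzags of odd length from `X` to `Y` in `C`,
`X = C₀ ← C₁ → C₂ ← ⋯ → Cₙ₋₁ ← Cₙ = Y`,
in which all the arrows pointing to the left belong to `W`.
The constructor `last` gives the zigzags `X ← Y` of length `1`, and the constructor `cons` adds
two arrows `X ← C₁ → C₂` on the left of a zigzag from `C₂` to `Y`. -/
inductive OddZigzag {C : Type u} [Category.{v} C] (W : MorphismProperty C) (Y : C) :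
    C → Type (max u v)
  | last {X : C} (d : Y ⟶ X) (hd : W d) : OddZigzag W Y X
  | cons {X C₁ C₂ : C} (d : C₁ ⟶ X) (hd : W d) (e : C₁ ⟶ C₂) (z : OddZigzag W Y C₂) :
      OddZigzag W Y X

namespace OddZigzag

/-- The image of a zigzag under a functor which preserves the distinguished classes. -/
def map {C : Type u} [Category.{v} C] {D : Type u'} [Category.{v'} D]
    {W : MorphismProperty C} {W' : MorphismProperty D} (F : C ⥤ D)
    (hF : ∀ ⦃A B : C⦄ (f : A ⟶ B), W f → W' (F.map f)) {Y : C} :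
    ∀ {X : C}, OddZigzag W Y X → OddZigzag W' (F.obj Y) (F.obj X)
  | _, last d hd => last (F.map d) (hF d hd)
  | _, cons d hd e z => cons (F.map d) (hF d hd) (F.map e) (map F hF z)

/-- The elementary reductions of zigzags: an identity arrow which is neither the first nor the
last arrow is omitted, and its two neighbours, which point in the same direction, are composed.
* `forward_last`, `forward`: the omitted identity points to the right
  (`forward_last` is the case where its right neighbour is the last arrow);
* `backward`: the omitted identity points to the left;
* `cons`: the reduction takes place further to the right. -/
inductive Reduction {C : Type u} [Category.{v} C] {W : MorphismProperty C} {Y : C} :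
    ∀ {X : C}, OddZigzag W Y X → OddZigzag W Y X → Prop
  | forward_last {X C₁ : C} (d : C₁ ⟶ X) (hd : W d) (d' : Y ⟶ C₁) (hd' : W d')
      (h : W (d' ≫ d)) :
      Reduction (.cons d hd (𝟙 C₁) (.last d' hd')) (.last (d' ≫ d) h)
  | forward {X C₁ C₂ C₃ : C} (d : C₁ ⟶ X) (hd : W d) (d' : C₂ ⟶ C₁) (hd' : W d')
      (h : W (d' ≫ d)) (e : C₂ ⟶ C₃) (z : OddZigzag W Y C₃) :
      Reduction (.cons d hd (𝟙 C₁) (.cons d' hd' e z)) (.cons (d' ≫ d) h e z)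
  | backward {X C₁ C₂ C₃ : C} (d : C₁ ⟶ X) (hd : W d) (e : C₁ ⟶ C₂) (h : W (𝟙 C₂))
      (e' : C₂ ⟶ C₃) (z : OddZigzag W Y C₃) :
      Reduction (.cons d hd e (.cons (𝟙 C₂) h e' z)) (.cons d hd (e ≫ e') z)
  | cons {X C₁ C₂ : C} (d : C₁ ⟶ X) (hd : W d) (e : C₁ ⟶ C₂) {z z' : OddZigzag W Y C₂}
      (h : Reduction z z') :
      Reduction (.cons d hd e z) (.cons d hd e z')

lemma Reduction.map {C : Type u} [Category.{v} C] {D : Type u'} [Category.{v'} D]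
    {W : MorphismProperty C} {W' : MorphismProperty D} (F : C ⥤ D)
    (hF : ∀ ⦃A B : C⦄ (f : A ⟶ B), W f → W' (F.map f)) {X Y : C} {z z' : OddZigzag W Y X}
    (h : Reduction z z') : Reduction (z.map F hF) (z'.map F hF) := by
  induction h with
  | forward_last d hd d' hd' h =>
    simp only [OddZigzag.map, F.map_id, F.map_comp]
    exact .forward_last _ _ _ _ _
  | forward d hd d' hd' h e z =>
    simp only [OddZigzag.map, F.map_id, F.map_comp]
    exact .forward _ _ _ _ _ _ _
  | backward d hd e h e' z =>
    simp only [OddZigzag.map, F.map_id, F.map_comp]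
    exact .backward _ _ _ _ _ _
  | cons d hd e h ih => exact .cons _ _ _ ih

end OddZigzag

/-- The constant functor `[k] ⥤ C` with value `X`. -/
abbrev constRow {C : Type u} [Category.{v} C] (k : ℕ) (X : C) : Fin (k + 1) ⥤ C :=
  (Functor.const (Fin (k + 1))).obj X

/-- A hammock of width `k` between `X` and `Y` (of any odd length `n`): a zigzag of length `n`
in the category of functors `[k] ⥤ C` from the constant functor `X` to the constant functor `Y`,
whose arrows pointing to the left belong to `W` objectwise. In other words, it is
a commutative diagram consisting of `k + 1` rows which are zigzags from `X` to `Y` of length `n`,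
and of vertical maps between consecutive rows, which are identities at both ends.
This is the same as a `k`-simplex of the nerve of the category whose objects are
the zigzags of length `n` from `X` to `Y`, a morphism of which is a commutative ladder that is
the identity at both ends. -/
abbrev Hammock {C : Type u} [Category.{v} C] (W : MorphismProperty C) (k : ℕ) (X Y : C) :=
  OddZigzag (W.functorCategory (Fin (k + 1))) (constRow k Y) (constRow k X)

/-- The precomposition with a nondecreasing map `[k'] → [k]`. -/
abbrev rowFunctor (C : Type u) [Category.{v} C] {Δ Δ' : SimplexCategoryᵒᵖ} (φ : Δ ⟶ Δ') :
    (Fin (Δ.unop.len + 1) ⥤ C) ⥤ (Fin (Δ'.unop.len + 1) ⥤ C) :=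
  (Functor.whiskeringLeft _ _ C).obj (SimplexCategory.toCat.map φ.unop).toFunctor

lemma rowFunctor_map_mem {C : Type u} [Category.{v} C] (W : MorphismProperty C)
    {Δ Δ' : SimplexCategoryᵒᵖ} (φ : Δ ⟶ Δ') ⦃A B : Fin (Δ.unop.len + 1) ⥤ C⦄ (f : A ⟶ B)
    (hf : W.functorCategory (Fin (Δ.unop.len + 1)) f) :
    W.functorCategory (Fin (Δ'.unop.len + 1)) ((rowFunctor C φ).map f) :=
  fun j => hf ((SimplexCategory.toCat.map φ.unop).toFunctor.obj j)

/-- The simplicial operators on hammocks, which repeat or delete rows. -/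
def Hammock.pull {C : Type u} [Category.{v} C] {W : MorphismProperty C}
    {Δ Δ' : SimplexCategoryᵒᵖ} (φ : Δ ⟶ Δ') {X Y : C} (z : Hammock W Δ.unop.len X Y) :
    Hammock W Δ'.unop.len X Y :=
  OddZigzag.map (rowFunctor C φ) (rowFunctor_map_mem W φ) z

lemma OddZigzag.map_rowFunctor_id {C : Type u} [Category.{v} C] {W : MorphismProperty C}
    {Δ : SimplexCategoryᵒᵖ} {X Y : Fin (Δ.unop.len + 1) ⥤ C}
    (z : OddZigzag (W.functorCategory (Fin (Δ.unop.len + 1))) Y X) :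
    OddZigzag.map (rowFunctor C (𝟙 Δ)) (rowFunctor_map_mem W (𝟙 Δ)) z = z := by
  induction z with
  | last d hd => rfl
  | cons d hd e z ih => exact congrArg (OddZigzag.cons d hd e) ih

lemma OddZigzag.map_rowFunctor_comp {C : Type u} [Category.{v} C] {W : MorphismProperty C}
    {Δ Δ' Δ'' : SimplexCategoryᵒᵖ} (φ : Δ ⟶ Δ') (ψ : Δ' ⟶ Δ'')
    {X Y : Fin (Δ.unop.len + 1) ⥤ C}
    (z : OddZigzag (W.functorCategory (Fin (Δ.unop.len + 1))) Y X) :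
    OddZigzag.map (rowFunctor C (φ ≫ ψ)) (rowFunctor_map_mem W (φ ≫ ψ)) z =
      OddZigzag.map (rowFunctor C ψ) (rowFunctor_map_mem W ψ)
        (OddZigzag.map (rowFunctor C φ) (rowFunctor_map_mem W φ) z) := by
  induction z with
  | last d hd => rfl
  | cons d hd e z ih => exact congrArg (OddZigzag.cons _ _ _) ih

/-- The mapping space `L^H C(X, Y)` of the hammock localization of `(C, W)`. Its `k`-simplices are
the hammocks of width `k` between `X` and `Y` of arbitrary odd length, where hammocks are
identified if they are related by a sequence of reductions (omitting an inner column which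
consists of identities only, and composing the two neighbouring columns) and their inverses.
In particular, hammocks are identified with those obtained by inserting two consecutive columns
of identities, so that this is a colimit of the nerves of the categories of zigzags of
length `n` over all the odd `n`. -/
def hammockMap {C : Type u} [Category.{v} C] (W : MorphismProperty C) (X Y : C) :
    SSet.{max u v} where
  obj Δ := Quot (OddZigzag.Reduction : Hammock W Δ.unop.len X Y → Hammock W Δ.unop.len X Y → Prop)
  map φ := ↾(Quot.map (Hammock.pull φ) (fun _ _ h => h.map _ _))
  map_id Δ := by
    ext z
    obtain ⟨z, rfl⟩ := Quot.exists_rep z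
    exact congrArg (Quot.mk _) z.map_rowFunctor_id
  map_comp φ ψ := by
    ext z
    obtain ⟨z, rfl⟩ := Quot.exists_rep z
    exact congrArg (Quot.mk _) (z.map_rowFunctor_comp φ ψ)

/-- Given `f : A ⟶ B`, the hammock from `A` to `Y` obtained from a hammock from `B` to `Y` by
adding the columns `A ← A` (the identity) and `f : A → B` on the left. -/
def Hammock.precomp {C : Type u} [Category.{v} C] {W : MorphismProperty C} [W.ContainsIdentities]
    {k : ℕ} {A B Y : C} (f : A ⟶ B) (z : Hammock W k B Y) : Hammock W k A Y :=
  .cons (𝟙 (constRow k A)) (fun _ => W.id_mem A) ((Functor.const (Fin (k + 1))).map f) z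

/-- The map `f^* : L^H C(B, Y) ⟶ L^H C(A, Y)` induced by `f : A ⟶ B`. -/
def hammockPrecomp {C : Type u} [Category.{v} C] (W : MorphismProperty C) [W.ContainsIdentities]
    {A B : C} (f : A ⟶ B) (Y : C) : hammockMap W B Y ⟶ hammockMap W A Y where
  app _ := ↾(Quot.map (Hammock.precomp f) (fun _ _ h => .cons _ _ _ h))
  naturality Δ Δ' φ := by
    ext z
    obtain ⟨z, rfl⟩ := Quot.exists_rep z
    rfl

/-! ### Weak homotopy equivalences of simplicial sets -/

/-- The set `[X, Z]` of simplicial homotopy classes of maps, that is `π₀` of the simplicial set of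
maps from `X` to `Z`. -/
def HomotopyClasses (X Z : SSet.{w}) : Type w :=
  Quot (fun g h : X ⟶ Z => Nonempty (SSet.Homotopy g h))

/-- The map `[Y, Z] → [X, Z]` induced by `f : X ⟶ Y`. -/
def HomotopyClasses.precomp {X Y : SSet.{w}} (f : X ⟶ Y) (Z : SSet.{w}) :
    HomotopyClasses Y Z → HomotopyClasses X Z :=
  Quot.map (fun g => f ≫ g) (by
    rintro g h ⟨H⟩
    exact ⟨{
      h := f ▷ _ ≫ H.h
      rel := by
        ext _ ⟨⟨_, hx⟩, _⟩
        exact hx.elim }⟩)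

/-- A map `f : X ⟶ Y` of simplicial sets is a weak homotopy equivalence if the
induced map `[Y, Z] → [X, Z]` is bijective for every Kan complex `Z`. -/
def IsWeakHomotopyEquivalence {X Y : SSet.{w}} (f : X ⟶ Y) : Prop :=
  ∀ (Z : SSet.{w}), SSet.KanComplex Z → Function.Bijective (HomotopyClasses.precomp f Z)

/-! ### Model categories, orthogonality and homotopy idempotent functors -/

/-- Two objects are weakly equivalent if they are connected by a zigzag of weak equivalences. -/
def WeaklyEquivalent {M : Type u} [Category.{v} M] [ModelCategory M] (X Y : M) : Prop :=
  Relation.EqvGen (fun A B : M => ∃ f : A ⟶ B, weakEquivalences M f) X Y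

/-- The homotopy mapping space `map(X, Y)` of a model category, given by the hammock
localization with respect to the class of all weak equivalences. -/
abbrev homMap {M : Type u} [Category.{v} M] [ModelCategory M] (X Y : M) : SSet.{max u v} :=
  hammockMap (weakEquivalences M) X Y

/-- A morphism `f : A ⟶ B` is simplicially orthogonal to an object `X` if the map
`f^* : map(B, X) ⟶ map(A, X)` is a weak homotopy equivalence. -/
def SimpliciallyOrthogonal {M : Type u} [Category.{v} M] [ModelCategory M] {A B : M}
    (f : A ⟶ B) (X : M) : Prop :=
  IsWeakHomotopyEquivalence (hammockPrecomp (weakEquivalences M) f X : homMap B X ⟶ homMap A X)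

/-- The simplicial orthogonal complement of a class `S` of morphisms: the fibrant objects
which are simplicially orthogonal to all the morphisms in `S`. -/
def orthogonalObjects {M : Type u} [Category.{v} M] [ModelCategory M]
    (S : MorphismProperty M) : ObjectProperty M :=
  fun X => IsFibrant X ∧ ∀ ⦃A B : M⦄ (f : A ⟶ B), S f → SimpliciallyOrthogonal f X

/-- The simplicial orthogonal complement of a class `D` of objects: the morphisms
which are simplicially orthogonal to all the objects in `D`. -/
def orthogonalMorphisms {M : Type u} [Category.{v} M] [ModelCategory M]
    (D : ObjectProperty M) : MorphismProperty M :=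
  fun _ _ f => ∀ X : M, D X → SimpliciallyOrthogonal f X

/-- A (coaugmented) homotopy idempotent functor `(L, ℓ)` on a model category. The functor
`(weakEquivalences M).Q` is the canonical functor from `M` to its homotopy category. -/
structure IsHomotopyIdempotent {M : Type u} [Category.{v} M] [ModelCategory M]
    (L : M ⥤ M) (ℓ : 𝟭 M ⟶ L) : Prop where
  map_mem ⦃X Y : M⦄ (f : X ⟶ Y) (hf : weakEquivalences M f) : weakEquivalences M (L.map f)
  eq_in_ho (X : M) : (weakEquivalences M).Q.map (ℓ.app (L.obj X)) =
    (weakEquivalences M).Q.map (L.map (ℓ.app X))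
  unit_obj_mem (X : M) : weakEquivalences M (ℓ.app (L.obj X))
  map_unit_mem (X : M) : weakEquivalences M (L.map (ℓ.app X))

/-- A morphism `f` is an `L`-equivalence if `L f` is a weak equivalence. -/
def localEquivalences {M : Type u} [Category.{v} M] [ModelCategory M] (L : M ⥤ M) :
    MorphismProperty M :=
  fun _ _ f => weakEquivalences M (L.map f)

/-- A fibrant object `X` is `L`-local if it is weakly equivalent to `L Y` for some `Y`. -/
def localObjects {M : Type u} [Category.{v} M] [ModelCategory M] (L : M ⥤ M) :
    ObjectProperty M :=
  fun X => IsFibrant X ∧ ∃ Y : M, WeaklyEquivalent X (L.obj Y)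

/-! The local objects are exactly the fibrant `X` for which `ℓ_X` is a weak equivalence. Indeed, the
class of objects whose unit is a weak equivalence contains every `L Y` and, by naturality of `ℓ` and
two-out-of-three, is invariant under zigzags of weak equivalences.

The central point is that an `L`-equivalence `f : A ⟶ B` is orthogonal to such an `X`
(`isWeakHomotopyEquivalence_of_map`). The natural transformation `ℓ` provides a simplicial homotopy
between `(ℓ_X)_*` and the composite `map(A, X) → map(LA, LX) → map(A, LX)` of the action of `L` with
`(ℓ_A)^*` (`homotopyPostcompHammockFunctor`). As weak equivalences in either variable induce
homotopy equivalences of mapping spaces, `(ℓ_X)_*` is one, and this exhibits `f^*` as a homotopy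
retract of `(L f)^*`, which is a homotopy equivalence because `L f` is a weak equivalence.

The converses are a Yoneda argument on connected components (`isIso_Q_map_of_hammockPrecomp`): if
`g^*` is bijective on `π₀` for maps to the source and to the target of `g`, then `g` becomes
invertible in the homotopy category. This only needs an evaluation map from `π₀` of the mapping
space to the morphisms of the homotopy category, compatible with composition on both sides, and not
its bijectivity. By saturation (`weakEquivalence_of_isIso_Q`), `g` is then a weak equivalence. The
argument is applied to `g = L f` for morphisms and to `g = ℓ_X` for objects. -/

/-! ### Weak homotopy equivalences and connected components -/

/-- The constant simplicial set on a set. -/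
abbrev SSet.discrete (S : Type w) : SSet.{w} := (Functor.const SimplexCategoryᵒᵖ).obj S

open Simplicial in
-- A simplex of a constant simplicial set is a single element, equal to each of its faces. Two faces
-- of a horn of dimension at least two meet, so all carry the same element; a horn of dimension one
-- has only one face.
lemma SSet.kanComplex_discrete (S : Type w) :
    SSet.KanComplex (SSet.discrete S) := by
  have key : ∀ {m n : ℕ} (g : ⦋m⦌ ⟶ ⦋n⦌)
      (φ : Δ[n] ⟶ SSet.discrete S),
      SSet.yonedaEquiv (SSet.stdSimplex.map g ≫ φ) = (SSet.yonedaEquiv φ : S) := by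
    intro m n g φ
    obtain ⟨s, rfl⟩ := SSet.yonedaEquiv.symm.surjective φ
    rw [Equiv.apply_symm_apply]
    rfl
  rw [SSet.KanComplex.iff]
  intro n i f hf
  obtain ⟨j₀, hj₀⟩ := exists_ne i
  refine ⟨SSet.yonedaEquiv.symm (SSet.yonedaEquiv (f j₀ hj₀) : S), fun j hj => ?_⟩
  apply SSet.yonedaEquiv.injective
  refine (key (SimplexCategory.δ j) _).trans ?_
  rw [Equiv.apply_symm_apply]
  by_cases hjj : j₀ = j
  · subst hjj; rfl
  obtain _ | n := n
  · exact absurd (by omega) hjj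
  · have h : ∀ (j k : Fin (n + 3)) (hj : j ≠ i) (hk : k ≠ i), j < k →
        (SSet.yonedaEquiv (f j hj) : S) = SSet.yonedaEquiv (f k hk) := by
      intro j k hj hk hjk
      have := congrArg SSet.yonedaEquiv (hf j k hj hk hjk)
      exact (key (SimplexCategory.δ _) _).symm.trans (this.trans (key (SimplexCategory.δ _) _))
    rcases lt_or_gt_of_ne hjj with h' | h'
    · exact h _ _ _ _ h'
    · exact (h _ _ _ _ h').symm

namespace HomotopyClasses

lemma precomp_comp {X Y K : SSet.{w}} (f : X ⟶ Y) (g : Y ⟶ K) (Z : SSet.{w}) :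
    precomp (f ≫ g) Z = precomp f Z ∘ precomp g Z := by
  funext z
  obtain ⟨z, rfl⟩ := Quot.exists_rep z
  exact congrArg (Quot.mk _) (Category.assoc f g z)

lemma precomp_id (X Z : SSet.{w}) : precomp (𝟙 X) Z = id := by
  funext z
  obtain ⟨z, rfl⟩ := Quot.exists_rep z
  exact congrArg (Quot.mk _) (Category.id_comp z)

lemma precomp_eq_of_homotopy {X Y : SSet.{w}} {f g : X ⟶ Y} (H : SSet.Homotopy f g)
    (Z : SSet.{w}) : precomp f Z = precomp g Z := by
  funext z
  obtain ⟨z, rfl⟩ := Quot.exists_rep z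
  refine Quot.sound ⟨{
      h := H.h ≫ z
      h₀ := ?_
      h₁ := ?_
      rel := by
        ext _ ⟨⟨_, hx⟩, _⟩
        exact hx.elim }⟩
  · exact (Category.assoc _ _ _).symm.trans (congrArg (· ≫ z) H.h₀)
  · exact (Category.assoc _ _ _).symm.trans (congrArg (· ≫ z) H.h₁)

end HomotopyClasses

open Simplicial in
-- On a vertex `x`, the homotopy is evaluated on the edge from `(x, 0)` to `(x, 1)` of the cylinder;
-- in a constant simplicial set both ends of an edge are equal. The other simplices are determined
-- by a vertex.
lemma SSet.Homotopy.eq_of_discrete {X : SSet.{w}} {S : Type w} {f g : X ⟶ SSet.discrete S}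
    (H : SSet.Homotopy f g) : f = g := by
  have h₀ : ∀ x : X _⦋0⦌, f.app _ x = g.app _ x := by
    intro x
    let e : (X ⊗ Δ[1] : SSet.{w}) _⦋1⦌ := (X.σ 0 x, SSet.yonedaEquiv (𝟙 _))
    have e₀ : (X ⊗ Δ[1] : SSet.{w}).δ 1 e = SSet.ι₀.app _ x := by
      refine Prod.ext ?_ ?_
      · exact ConcreteCategory.congr_hom (X.δ_comp_σ_succ (i := (0 : Fin 1))) x
      · ext k; fin_cases k; rfl
    have e₁ : (X ⊗ Δ[1] : SSet.{w}).δ 0 e = SSet.ι₁.app _ x := by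
      refine Prod.ext ?_ ?_
      · exact ConcreteCategory.congr_hom (X.δ_comp_σ_self (i := (0 : Fin 1))) x
      · ext k; fin_cases k; rfl
    have n₀ := NatTrans.naturality_apply H.h (SimplexCategory.δ (1 : Fin 2)).op e
    have n₁ := NatTrans.naturality_apply H.h (SimplexCategory.δ (0 : Fin 2)).op e
    have a₀ : H.h.app _ (SSet.ι₀.app _ x) = f.app _ x :=
      ConcreteCategory.congr_hom (congr_app H.h₀ _) x
    have a₁ : H.h.app _ (SSet.ι₁.app _ x) = g.app _ x :=
      ConcreteCategory.congr_hom (congr_app H.h₁ _) x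
    exact a₀.symm.trans ((congrArg (H.h.app _) e₀).symm.trans (n₀.trans
      (n₁.symm.trans ((congrArg (H.h.app _) e₁).trans a₁))))
  ext Δ x
  have nf := NatTrans.naturality_apply f (SimplexCategory.const ⦋0⦌ Δ.unop 0).op x
  have ng := NatTrans.naturality_apply g (SimplexCategory.const ⦋0⦌ Δ.unop 0).op x
  exact nf.symm.trans ((h₀ _).trans ng)

open Simplicial in
/-- A weak homotopy equivalence induces a bijection between the maps to a set. -/
lemma IsWeakHomotopyEquivalence.bijective_discrete {X Y : SSet.{w}} {f : X ⟶ Y}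
    (hf : IsWeakHomotopyEquivalence f) (S : Type w) :
    Function.Bijective
      (fun g : Y ⟶ SSet.discrete S => f ≫ g) := by
  have eq : ∀ {K : SSet.{w}} {a b : K ⟶ SSet.discrete S},
      (Quot.mk _ a : HomotopyClasses K _) = Quot.mk _ b → a = b := by
    intro K a b h
    have h := congrArg (Quot.lift (fun a => a) (fun _ _ ⟨H⟩ => H.eq_of_discrete)) h
    exact h
  have := hf _ (SSet.kanComplex_discrete S)
  refine ⟨fun a b h => ?_, fun a => ?_⟩
  · exact eq (this.1 (congrArg (Quot.mk _) h : HomotopyClasses.precomp f _ (Quot.mk _ a) =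
      HomotopyClasses.precomp f _ (Quot.mk _ b)))
  · obtain ⟨b, hb⟩ := this.2 (Quot.mk _ a)
    obtain ⟨b, rfl⟩ := Quot.exists_rep b
    exact ⟨b, eq hb⟩

open Simplicial in
/-- The map to a set induced by a map from the set of connected components. -/
def SSet.toDiscrete {X : SSet.{w}} {S : Type w} (c : SSet.π₀ X → S) :
    X ⟶ SSet.discrete S where
  app Δ := ↾(fun x => c (.mk (X.map (SimplexCategory.const ⦋0⦌ Δ.unop 0).op x)))
  naturality Δ Δ' φ := by
    ext x
    refine congrArg c (Eq.symm ?_)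
    -- The first vertex of `φ^* x` is the vertex `φ 0` of `x`; this edge of `x` joins it to the
    -- vertex `0`.
    let a : ⦋1⦌ ⟶ Δ.unop :=
      SimplexCategory.mkOfLe (n := Δ.unop.len) 0 (φ.unop.toOrderHom 0) (Fin.zero_le _)
    have e := SSet.π₀.sound (SSet.Edge.mk' (X.map a.op x))
    refine Eq.trans (congrArg SSet.π₀.mk ?_) (e.trans (congrArg SSet.π₀.mk ?_))
    · refine Eq.trans ?_ (X.map_comp_apply a.op (SimplexCategory.δ 1).op x)
      rw [← op_comp]
      congr 4
      ext k; fin_cases k; rfl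
    · refine (X.map_comp_apply a.op (SimplexCategory.δ 0).op x).symm.trans
        (Eq.trans ?_ (X.map_comp_apply φ (SimplexCategory.const ⦋0⦌ Δ'.unop 0).op x))
      rw [← op_comp]
      congr 3
      apply Quiver.Hom.unop_inj
      ext k; fin_cases k; rfl

lemma SSet.toDiscrete_app {X : SSet.{w}} {S : Type w} (c : SSet.π₀ X → S)
    (x : X.obj (op (SimplexCategory.mk 0))) : (SSet.toDiscrete c).app _ x = c (.mk x) := by
  refine congrArg c (congrArg SSet.π₀.mk ?_)
  rw [Subsingleton.elim (SimplexCategory.const _ _ _) (𝟙 _)]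
  simp

/-- A weak homotopy equivalence induces a bijection between the sets of connected components. -/
lemma IsWeakHomotopyEquivalence.bijective_mapπ₀ {X Y : SSet.{w}} {f : X ⟶ Y}
    (hf : IsWeakHomotopyEquivalence f) : Function.Bijective (SSet.mapπ₀ f) := by
  have comp : ∀ {S : Type w} (c : SSet.π₀ Y → S),
      f ≫ SSet.toDiscrete c = SSet.toDiscrete (c ∘ SSet.mapπ₀ f) := by
    intro S c
    ext Δ x
    refine congrArg c (Eq.trans ?_ (SSet.mapπ₀_mk f _).symm)
    exact congrArg SSet.π₀.mk (NatTrans.naturality_apply f _ x).symm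
  constructor
  · intro x x' h
    -- The canonical map from `X` to `π₀ X` extends along `f`; on components the extension is a left
    -- inverse of `π₀ f`.
    obtain ⟨c, hc⟩ := (hf.bijective_discrete (SSet.π₀ X)).2 (SSet.toDiscrete id)
    obtain ⟨x, rfl⟩ := x.mk_surjective
    obtain ⟨x', rfl⟩ := x'.mk_surjective
    have hf' : ∀ z : X.obj (op (SimplexCategory.mk 0)), c.app _ (f.app _ z) = SSet.π₀.mk z :=
      fun z => (ConcreteCategory.congr_hom (congr_app hc _) z).trans (SSet.toDiscrete_app _ z)
    have hc' : ∀ z z' : Y.obj (op (SimplexCategory.mk 0)), SSet.π₀.mk z = SSet.π₀.mk z' →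
        (c.app _ z : SSet.π₀ X) = c.app _ z' := by
      intro z z' h
      refine congrArg (SSet.π₀.lift (T := SSet.π₀ X) (fun z => c.app _ z) ?_) h
      intro x₀ x₁ e
      exact (congrArg (c.app _) e.src_eq).symm.trans
        ((NatTrans.naturality_apply c (SimplexCategory.δ (1 : Fin 2)).op e.edge).trans
        ((NatTrans.naturality_apply c (SimplexCategory.δ (0 : Fin 2)).op e.edge).symm.trans
        (congrArg (c.app _) e.tgt_eq)))
    exact (hf' x).symm.trans ((hc' _ _ h).trans (hf' x'))
  · intro y
    -- The indicator of the image of `π₀ f` agrees with the constant `True` after restriction along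
    -- `f`, hence everywhere.
    let c : SSet.π₀ Y → ULift.{w} Prop := fun y => ⟨∃ x, SSet.mapπ₀ f x = y⟩
    have h := (hf.bijective_discrete (ULift.{w} Prop)).1
      (a₁ := SSet.toDiscrete c) (a₂ := SSet.toDiscrete fun _ => ⟨True⟩) (by
        dsimp only
        rw [comp, comp]
        congr 1
        funext x
        exact congrArg ULift.up (eq_true ⟨x, rfl⟩))
    obtain ⟨y, rfl⟩ := y.mk_surjective
    have h' := ConcreteCategory.congr_hom (congr_app h (op (SimplexCategory.mk 0))) y
    have h'' := (SSet.toDiscrete_app c y).symm.trans (h'.trans (SSet.toDiscrete_app _ y))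
    exact (congrArg ULift.down h'').mpr trivial

/-! ### Saturation of the weak equivalences of a model category -/

section

variable {M : Type u} [Category.{v} M] [ModelCategory M]

/-- The homotopy lifting property turns a homotopy inverse of `p` into a strict section `s`. Then `p
≫ s` is homotopic to the identity, hence a weak equivalence, and `p` is a retract of it. -/
lemma weakEquivalence_of_fibration_of_isIso_Q {X Y : M} [IsCofibrant X] [IsFibrant X]
    [IsCofibrant Y] [IsFibrant Y] (p : X ⟶ Y) [Fibration p]
    [IsIso ((weakEquivalences M).Q.map p)] : WeakEquivalence p := by
  let Q := (weakEquivalences M).Q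
  have : IsIso (Q.map p) := by assumption
  obtain ⟨s', hs'⟩ := map_surjective_of_isLocalization Q Y X (inv (Q.map p))
  have h : LeftHomotopyRel (s' ≫ p) (𝟙 Y) := by
    rw [LeftHomotopyRel.iff_map_eq Q, Q.map_comp, hs', IsIso.inv_hom_id, Q.map_id]
  obtain ⟨P, _, ⟨H⟩⟩ := h.exists_good_cylinder
  have sq : CommSq s' P.i₀ p H.h := ⟨H.h₀.symm⟩
  let s := P.i₁ ≫ sq.lift
  have hs : s ≫ p = 𝟙 Y := by simp [s]
  have hQs : Q.map s = inv (Q.map p) := by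
    rw [← cancel_mono (Q.map p), ← Q.map_comp, hs, IsIso.inv_hom_id, Q.map_id]
  have h' : RightHomotopyRel (p ≫ s) (𝟙 X) := by
    rw [RightHomotopyRel.iff_map_eq Q, Q.map_comp, hQs, IsIso.hom_inv_id, Q.map_id]
  obtain ⟨P', ⟨H'⟩⟩ := h'
  have : WeakEquivalence (p ≫ s) := H'.weakEquivalence_iff.2 inferInstance
  rw [weakEquivalence_iff] at this ⊢
  refine MorphismProperty.of_retract (f := p) (g := p ≫ s) ?_ this
  exact
    { i := Arrow.homMk (𝟙 X) s (by simp)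
      r := Arrow.homMk (𝟙 X) p (by simp [hs])
      retract := by ext <;> simp [hs] }

/-- Splitting off a trivial cofibration reduces to the case of a fibration. -/
lemma weakEquivalence_of_isIso_Q_of_bifibrant {X Y : M} [IsCofibrant X] [IsFibrant X]
    [IsCofibrant Y] [IsFibrant Y] (f : X ⟶ Y)
    [IsIso ((weakEquivalences M).Q.map f)] : WeakEquivalence f := by
  let Q := (weakEquivalences M).Q
  have : IsIso (Q.map f) := by assumption
  let h := MorphismProperty.factorizationData (trivialCofibrations M) (fibrations M) f
  have : IsCofibrant h.Z := isCofibrant_of_cofibration h.i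
  have : IsFibrant h.Z := isFibrant_of_fibration h.p
  have : IsIso (Q.map h.i) := Localization.inverts Q (weakEquivalences M) _
    (by rw [← weakEquivalence_iff]; infer_instance)
  have : IsIso (Q.map h.p) := by
    have : IsIso (Q.map h.i ≫ Q.map h.p) := by
      rw [← Q.map_comp, h.fac]; infer_instance
    exact IsIso.of_isIso_comp_left (Q.map h.i) _
  have := weakEquivalence_of_fibration_of_isIso_Q h.p
  rw [← h.fac]
  infer_instance

/-- The morphisms of a model category which become isomorphisms in the homotopy category are the
weak equivalences. -/
lemma weakEquivalence_of_isIso_Q {X Y : M} (f : X ⟶ Y)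
    [IsIso ((weakEquivalences M).Q.map f)] : WeakEquivalence f := by
  let Q := (weakEquivalences M).Q
  have hQ : ∀ {A B : M} (g : A ⟶ B) [WeakEquivalence g], IsIso (Q.map g) := fun g _ =>
    Localization.inverts Q (weakEquivalences M) _ (by rwa [← weakEquivalence_iff])
  have : IsIso (Q.map f) := by assumption
  -- A cofibrant and then a fibrant replacement leave a morphism between bifibrant objects.
  rw [← CofibrantObject.HoCat.weakEquivalence_resolutionMap_iff,
    ← FibrantObject.HoCat.weakEquivalence_resolutionMap_iff]
  have : IsIso (Q.map (CofibrantObject.HoCat.resolutionMap f)) := by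
    have := hQ (CofibrantObject.HoCat.pResolutionObj X)
    have := hQ (CofibrantObject.HoCat.pResolutionObj Y)
    have h := congrArg Q.map (CofibrantObject.HoCat.resolutionMap_fac f)
    rw [Q.map_comp, Q.map_comp] at h
    rw [(IsIso.eq_comp_inv _).2 h]
    infer_instance
  generalize CofibrantObject.HoCat.resolutionMap f = g at *
  have : IsIso (Q.map (FibrantObject.HoCat.resolutionMap g)) := by
    have := hQ (FibrantObject.HoCat.iResolutionObj (CofibrantObject.HoCat.resolutionObj X))
    have := hQ (FibrantObject.HoCat.iResolutionObj (CofibrantObject.HoCat.resolutionObj Y))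
    have h := congrArg Q.map (FibrantObject.HoCat.resolutionMap_fac g)
    rw [Q.map_comp, Q.map_comp] at h
    rw [(IsIso.eq_inv_comp _).2 h]
    infer_instance
  exact weakEquivalence_of_isIso_Q_of_bifibrant _

end

/-! ### Operations on zigzags -/

namespace OddZigzag

section

variable {C : Type u} [Category.{v} C] {D : Type u'} [Category.{v'} D]
  {W : MorphismProperty C} {W' : MorphismProperty D}

/-- The classes of zigzags from `X` to `Y` up to reductions. -/
abbrev Class (W : MorphismProperty C) (Y X : C) :=
  Quot (Reduction : OddZigzag W Y X → OddZigzag W Y X → Prop)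

/-- The class of a zigzag up to reductions. -/
abbrev toClass {Y X : C} (z : OddZigzag W Y X) : Class W Y X := Quot.mk _ z

lemma cons_congr {X Y C₁ C₂ : C} {d d' : C₁ ⟶ X} (hd : W d) (hd' : W d') {e e' : C₁ ⟶ C₂}
    (z : OddZigzag W Y C₂) (h : d = d') (h' : e = e') :
    cons d hd e z = cons d' hd' e' z := by
  subst h h'; rfl

lemma toClass_cons {X Y C₁ C₂ : C} (d : C₁ ⟶ X) (hd : W d) (e : C₁ ⟶ C₂)
    {z z' : OddZigzag W Y C₂} (h : z.toClass = z'.toClass) :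
    (cons d hd e z).toClass = (cons d hd e z').toClass :=
  congrArg (Quot.map (cons d hd e) (fun _ _ h => .cons _ _ _ h)) h

/-- The zigzag obtained by adding two arrows `Y ⟶ Q` and `Q ⟵ Y'` on the right. -/
def extendRight {Y Q Y' : C} (e : Y ⟶ Q) (d : Y' ⟶ Q) (hd : W d) :
    ∀ {X : C}, OddZigzag W Y X → OddZigzag W Y' X
  | _, last d₀ h₀ => cons d₀ h₀ e (last d hd)
  | _, cons d₀ h₀ e₀ z => cons d₀ h₀ e₀ (extendRight e d hd z)

lemma extendRight_congr {X Y Q Y' : C} {e e' : Y ⟶ Q} {d d' : Y' ⟶ Q} (hd : W d) (hd' : W d')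
    (z : OddZigzag W Y X) (h : e = e') (h' : d = d') :
    extendRight e d hd z = extendRight e' d' hd' z := by
  subst h h'; rfl

lemma Reduction.extendRight {X Y Q Y' : C} (e : Y ⟶ Q) (d : Y' ⟶ Q) (hd : W d)
    {z z' : OddZigzag W Y X} (h : Reduction z z') :
    Reduction (z.extendRight e d hd) (z'.extendRight e d hd) := by
  induction h with
  -- The formerly last arrow now has a successor, so the generic forward reduction applies.
  | forward_last d hd d' hd' h => exact .forward _ _ _ _ _ _ _
  | forward d hd d' hd' h e z => exact .forward _ _ _ _ _ _ _
  | backward d hd e h e' z => exact .backward _ _ _ _ _ _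
  | cons d hd e h ih => exact .cons _ _ _ ih

lemma map_extendRight (F : C ⥤ D) (hF : ∀ ⦃A B : C⦄ (f : A ⟶ B), W f → W' (F.map f))
    {X Y Q Y' : C} (e : Y ⟶ Q) (d : Y' ⟶ Q) (hd : W d) (z : OddZigzag W Y X) :
    (z.extendRight e d hd).map F hF =
      (z.map F hF).extendRight (F.map e) (F.map d) (hF d hd) := by
  induction z with
  | last d₀ h₀ => rfl
  | cons d₀ h₀ e₀ z ih => exact congrArg (cons _ _ _) ih

/-- The forward identity is an inner column; omitting it composes the added backward identity with
the first arrow of `z`. -/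
lemma toClass_cons_id_id {X Y : C} (h : W (𝟙 X)) (z : OddZigzag W Y X) :
    (cons (𝟙 X) h (𝟙 X) z).toClass = z.toClass := by
  cases z with
  | last d hd =>
    refine (Quot.sound (.forward_last _ _ _ _ (by simpa using hd))).trans ?_
    simp only [Category.comp_id]
  | cons d hd e z =>
    refine (Quot.sound (.forward _ _ _ _ (by simpa using hd) _ _)).trans ?_
    simp only [Category.comp_id]

lemma toClass_cons_cons_id {X Y C₁ C₂ C₃ : C} (d : C₁ ⟶ X) (hd : W d) (e : C₁ ⟶ C₂)
    (h : W (𝟙 C₂)) (e' : C₂ ⟶ C₃) (z : OddZigzag W Y C₃) :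
    (cons d hd e (cons (𝟙 C₂) h e' z)).toClass = (cons d hd (e ≫ e') z).toClass :=
  Quot.sound (.backward _ _ _ _ _ _)

lemma toClass_extendRight_id_id {X Y : C} (h : W (𝟙 Y)) (z : OddZigzag W Y X) :
    (z.extendRight (𝟙 Y) (𝟙 Y) h).toClass = z.toClass := by
  induction z with
  | last d hd =>
    refine (Quot.sound (.forward_last _ _ _ _ (by simpa using hd))).trans ?_
    simp only [Category.id_comp]
  | cons d hd e z ih => exact toClass_cons _ _ _ ih

lemma toClass_extendRight_extendRight_id {X Y Y' Y'' Q : C} (e : Y ⟶ Q) (d : Y' ⟶ Q) (hd : W d)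
    (d' : Y'' ⟶ Y') (hd' : W d') (h : W (d' ≫ d)) (z : OddZigzag W Y X) :
    ((z.extendRight e d hd).extendRight (𝟙 Y') d' hd').toClass =
      (z.extendRight e (d' ≫ d) h).toClass := by
  induction z with
  | last d₀ h₀ => exact Quot.sound (.cons _ _ _ (.forward_last _ _ _ _ _))
  | cons d₀ h₀ e₀ z ih => exact toClass_cons _ _ _ ih

end

end OddZigzag

/-! ### Maps and homotopies between the mapping spaces -/

section

open OddZigzag

variable {C : Type u} [Category.{v} C] {W : MorphismProperty C}

/-- Constructor for maps between mapping spaces. -/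
def hammockMap.mkHom {X Y X' Y' : C}
    (T : ∀ (Δ : SimplexCategoryᵒᵖ), Hammock W Δ.unop.len X Y → Hammock W Δ.unop.len X' Y')
    (hT : ∀ Δ z z', Reduction z z' → (T Δ z).toClass = (T Δ z').toClass)
    (nat : ∀ ⦃Δ Δ' : SimplexCategoryᵒᵖ⦄ (ψ : Δ ⟶ Δ') (z : Hammock W Δ.unop.len X Y),
      toClass (Hammock.pull ψ (T Δ z)) = toClass (T Δ' (Hammock.pull ψ z))) :
    hammockMap W X Y ⟶ hammockMap W X' Y' where
  app Δ := ↾(Quot.lift (fun z => (T Δ z).toClass) (hT Δ))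
  naturality Δ Δ' ψ := by
    ext z
    obtain ⟨z, rfl⟩ := Quot.exists_rep z
    exact (nat ψ z).symm

lemma hammockMap.hom_ext {X Y : C} {K : SSet.{max u v}} {f g : hammockMap W X Y ⟶ K}
    (h : ∀ (Δ : SimplexCategoryᵒᵖ) (z : Hammock W Δ.unop.len X Y),
      f.app Δ z.toClass = g.app Δ z.toClass) : f = g := by
  ext Δ z
  obtain ⟨z, rfl⟩ := Quot.exists_rep z
  exact h Δ z

open Simplicial in
/-- Constructor for homotopies between maps from mapping spaces. -/
def hammockMap.mkHomotopy {X Y X' Y' : C} {f g : hammockMap W X Y ⟶ hammockMap W X' Y'}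
    (T : ∀ (Δ : SimplexCategoryᵒᵖ) (_ : Δ.unop ⟶ ⦋1⦌),
      Hammock W Δ.unop.len X Y → Hammock W Δ.unop.len X' Y')
    (hT : ∀ Δ φ z z', Reduction z z' → (T Δ φ z).toClass = (T Δ φ z').toClass)
    (nat : ∀ ⦃Δ Δ' : SimplexCategoryᵒᵖ⦄ (ψ : Δ ⟶ Δ') (φ : Δ.unop ⟶ ⦋1⦌)
      (z : Hammock W Δ.unop.len X Y),
      toClass (Hammock.pull ψ (T Δ φ z)) = toClass (T Δ' (ψ.unop ≫ φ) (Hammock.pull ψ z)))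
    (h₀ : ∀ Δ φ z, (∀ j, φ.toOrderHom j = 0) → (T Δ φ z).toClass = f.app Δ z.toClass)
    (h₁ : ∀ Δ φ z, (∀ j, φ.toOrderHom j = 1) → (T Δ φ z).toClass = g.app Δ z.toClass) :
    SSet.Homotopy f g where
  h :=
    -- A simplex of the cylinder is a hammock with a map `φ` to `[1]`, which splits its rows into
    -- those over `0` and those over `1`.
    { app Δ := ↾(fun z => Quot.lift (fun x => (T Δ (SSet.stdSimplex.objEquiv z.2) x).toClass)
        (hT Δ _) z.1)
      naturality Δ Δ' ψ := by
        ext ⟨z, φ⟩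
        obtain ⟨z, rfl⟩ := Quot.exists_rep z
        exact (nat ψ _ z).symm }
  h₀ := hammockMap.hom_ext fun Δ z => h₀ Δ _ z fun _ => rfl
  h₁ := hammockMap.hom_ext fun Δ z => h₁ Δ _ z fun _ => rfl
  rel := by
    ext _ ⟨⟨_, hx⟩, _⟩
    exact hx.elim

end

/-! ### Functoriality with respect to weak equivalences -/

/-- Reductions omit only genuine identities, so at the ends of a homotopy the interpolating rows
must equal constant rows, not merely be isomorphic to them. Once the equality is substituted,
`eqToHom` is an identity. -/
lemma NatTrans.eq_eqToHom {J : Type u} [Category.{v} J] {C : Type u'} [Category.{v'} C]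
    {F G : J ⥤ C} (τ : F ⟶ G) (h : ∀ j, ∃ hj : F.obj j = G.obj j, τ.app j = eqToHom hj) :
    ∃ h' : F = G, τ = eqToHom h' := by
  have h' : F = G := CategoryTheory.Functor.ext (fun j => (h j).choose) (fun i j f => by
    have := τ.naturality f
    rw [(h i).choose_spec, (h j).choose_spec] at this
    rw [← reassoc_of% this]
    simp)
  subst h'
  refine ⟨rfl, ?_⟩
  exact CategoryTheory.NatTrans.ext (funext fun j => (h j).choose_spec)

/-! ### Rows interpolating between two constant rows -/

section

open OddZigzag Simplicial

variable {C : Type u} [Category.{v} C] {W : MorphismProperty C}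

/-- The functor `[k] ⥤ [1]` corresponding to a simplex of `Δ[1]`. -/
abbrev rowIndex {Δ : SimplexCategory} (φ : Δ ⟶ ⦋1⦌) : Fin (Δ.len + 1) ⥤ Fin 2 :=
  φ.toOrderHom.monotone.functor

/-- The row of objects of `C`, equal to `A` or `B`, and of morphisms, equal to `f : A ⟶ B` or to
identities, given by a simplex of `Δ[1]`. -/
abbrev mixedRow {A B : C} (f : A ⟶ B) {Δ : SimplexCategory} (φ : Δ ⟶ ⦋1⦌) :
    Fin (Δ.len + 1) ⥤ C :=
  rowIndex φ ⋙ ComposableArrows.mk₁ f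

/-- The map from the constant row to the mixed row. -/
def toMixedRow {A B : C} (f : A ⟶ B) {Δ : SimplexCategory} (φ : Δ ⟶ ⦋1⦌) :
    constRow Δ.len A ⟶ mixedRow f φ where
  app j := (ComposableArrows.mk₁ f).map (homOfLE (Fin.zero_le (φ.toOrderHom j)))
  naturality i j g := by
    refine (Category.id_comp _).trans ?_
    exact (Functor.map_comp (ComposableArrows.mk₁ f) (homOfLE _) ((rowIndex φ).map g))

/-- The map from the mixed row to the constant row. -/
def fromMixedRow {A B : C} (f : A ⟶ B) {Δ : SimplexCategory} (φ : Δ ⟶ ⦋1⦌) :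
    mixedRow f φ ⟶ constRow Δ.len B where
  app j := (ComposableArrows.mk₁ f).map (homOfLE (Fin.le_last (φ.toOrderHom j)))
  naturality i j g := by
    refine Eq.trans ?_ (Category.comp_id _).symm
    exact (Functor.map_comp (ComposableArrows.mk₁ f) ((rowIndex φ).map g) (homOfLE _)).symm

lemma mk₁_map_mem [W.ContainsIdentities] {A B : C} (f : A ⟶ B) (hf : W f) :
    ∀ {i j : Fin 2} (g : i ⟶ j), W ((ComposableArrows.mk₁ f).map g) := by
  intro i j g
  match i, j with
  | 0, 0 => exact W.id_mem A
  | 0, 1 => exact hf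
  | 1, 1 => exact W.id_mem B
  | 1, 0 => exact absurd (leOfHom g) (by decide)

lemma toMixedRow_mem [W.ContainsIdentities] {A B : C} (f : A ⟶ B) (hf : W f)
    {Δ : SimplexCategory} (φ : Δ ⟶ ⦋1⦌) :
    W.functorCategory (Fin (Δ.len + 1)) (toMixedRow f φ) :=
  fun j => mk₁_map_mem f hf (homOfLE (Fin.zero_le (φ.toOrderHom j)))

lemma fromMixedRow_mem [W.ContainsIdentities] {A B : C} (f : A ⟶ B) (hf : W f)
    {Δ : SimplexCategory} (φ : Δ ⟶ ⦋1⦌) :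
    W.functorCategory (Fin (Δ.len + 1)) (fromMixedRow f φ) :=
  fun j => mk₁_map_mem f hf (homOfLE (Fin.le_last (φ.toOrderHom j)))

lemma mixedRow_zero {A B : C} (f : A ⟶ B) {Δ : SimplexCategory} (φ : Δ ⟶ ⦋1⦌)
    (hφ : ∀ j, φ.toOrderHom j = 0) :
    ∃ h : constRow Δ.len A = mixedRow f φ, toMixedRow f φ = eqToHom h := by
  refine NatTrans.eq_eqToHom _ fun j => ?_
  have key : ∀ i : Fin 2, i = 0 →
      ∃ hj : A = (ComposableArrows.mk₁ f).obj i,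
        (ComposableArrows.mk₁ f).map (homOfLE (Fin.zero_le i)) = eqToHom hj := by
    rintro _ rfl
    exact ⟨rfl, rfl⟩
  exact key _ (hφ j)

lemma mixedRow_one {A B : C} (f : A ⟶ B) {Δ : SimplexCategory} (φ : Δ ⟶ ⦋1⦌)
    (hφ : ∀ j, φ.toOrderHom j = 1) :
    ∃ h : mixedRow f φ = constRow Δ.len B, fromMixedRow f φ = eqToHom h := by
  refine NatTrans.eq_eqToHom _ fun j => ?_
  have key : ∀ i : Fin 2, i = 1 →
      ∃ hj : (ComposableArrows.mk₁ f).obj i = B,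
        (ComposableArrows.mk₁ f).map (homOfLE (Fin.le_last i)) = eqToHom hj := by
    rintro _ rfl
    exact ⟨rfl, rfl⟩
  exact key _ (hφ j)

lemma toMixedRow_fromMixedRow {A B : C} (f : A ⟶ B) {Δ : SimplexCategory} (φ : Δ ⟶ ⦋1⦌) :
    toMixedRow f φ ≫ fromMixedRow f φ = (Functor.const _).map f := by
  ext j
  exact ((ComposableArrows.mk₁ f).map_comp (homOfLE (Fin.zero_le (φ.toOrderHom j)))
    (homOfLE (Fin.le_last (φ.toOrderHom j)))).symm

end

/-! ### Homotopy inverses of `f^*` and `g_*` when `f` and `g` are distinguished -/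

section

open OddZigzag Simplicial

variable {C : Type u} [Category.{v} C] (W : MorphismProperty C)

/-- The map `g_* : L^H C(X, Y) ⟶ L^H C(X, Y')` induced by `g : Y ⟶ Y'`. -/
def hammockPostcomp [W.ContainsIdentities] (X : C) {Y Y' : C} (g : Y ⟶ Y') :
    hammockMap W X Y ⟶ hammockMap W X Y' :=
  hammockMap.mkHom
    (fun _ z => z.extendRight ((Functor.const _).map g) (𝟙 (constRow _ Y')) (fun _ => W.id_mem Y'))
    (fun _ _ _ h => Quot.sound (h.extendRight _ _ _))
    (fun _ _ _ _ => congrArg _ (map_extendRight _ _ _ _ _ _))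

/-- The map `L^H C(A, Y) ⟶ L^H C(B, Y)` induced by the inverse of `f : A ⟶ B`. -/
def hammockPrecompInv {A B : C} (f : A ⟶ B) (hf : W f) (Y : C) :
    hammockMap W A Y ⟶ hammockMap W B Y :=
  hammockMap.mkHom
    (fun _ z => .cons ((Functor.const _).map f) (fun _ => hf) (𝟙 (constRow _ A)) z)
    (fun _ _ _ h => Quot.sound (.cons _ _ _ h))
    (fun _ _ _ _ => rfl)

/-- The map `L^H C(X, Y') ⟶ L^H C(X, Y)` induced by the inverse of `g : Y ⟶ Y'`. -/
def hammockPostcompInv (X : C) {Y Y' : C} (g : Y ⟶ Y') (hg : W g) :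
    hammockMap W X Y' ⟶ hammockMap W X Y :=
  hammockMap.mkHom
    (fun _ z => z.extendRight (𝟙 (constRow _ Y')) ((Functor.const _).map g) (fun _ => hg))
    (fun _ _ _ h => Quot.sound (h.extendRight _ _ _))
    (fun _ _ _ _ => congrArg _ (map_extendRight _ _ _ _ _ _))

/-- The homotopy from the identity to the composition of the inverse of `f^*` with `f^*`. -/
def homotopyInvPrecomp [W.ContainsIdentities] {A B : C} (f : A ⟶ B) (hf : W f) (Y : C) :
    SSet.Homotopy (𝟙 (hammockMap W A Y)) (hammockPrecompInv W f hf Y ≫ hammockPrecomp W f Y) :=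
  hammockMap.mkHomotopy
    -- The hammock begins with `A ← A → R ← A → A`, where `R` is the mixed row: everything is an
    -- identity over `0`, and the arrows into `R` are `f` over `1`.
    (fun Δ φ z => .cons (𝟙 (constRow _ A)) (fun _ => W.id_mem A) (toMixedRow f φ)
      (.cons (toMixedRow f φ) (toMixedRow_mem f hf φ) (𝟙 (constRow _ A)) z))
    (fun _ _ _ _ h => Quot.sound (.cons _ _ _ (.cons _ _ _ h)))
    (fun _ _ _ _ _ => rfl)
    (fun Δ φ z hφ => by
      obtain ⟨h, h'⟩ := mixedRow_zero f φ hφ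
      -- The mixed row is replaced by a variable `R`, against which the equality of functors can be
      -- eliminated.
      have key : ∀ {R : Fin (Δ.unop.len + 1) ⥤ C} (t : constRow Δ.unop.len A ⟶ R)
          (ht : W.functorCategory _ t) (h : constRow Δ.unop.len A = R), t = eqToHom h →
          toClass (.cons (𝟙 (constRow _ A)) (fun _ => W.id_mem A) t
            (.cons t ht (𝟙 (constRow _ A)) z)) = toClass z := by
        rintro R t ht rfl rfl
        exact (toClass_cons_id_id _ _).trans (toClass_cons_id_id _ _)
      exact key _ _ h h')
    (fun Δ φ z hφ => by
      obtain ⟨h, h'⟩ := mixedRow_one f φ hφ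
      have key : ∀ {R : Fin (Δ.unop.len + 1) ⥤ C} (t : constRow Δ.unop.len A ⟶ R)
          (ht : W.functorCategory _ t) (s : R ⟶ constRow _ B) (h : R = constRow _ B),
          s = eqToHom h → t ≫ s = (Functor.const _).map f →
          toClass (.cons (𝟙 (constRow _ A)) (fun _ => W.id_mem A) t
            (.cons t ht (𝟙 (constRow _ A)) z)) = toClass (Hammock.precomp f
              (.cons ((Functor.const _).map f) (fun _ => hf) (𝟙 (constRow _ A)) z)) := by
        rintro R t ht s rfl rfl hts
        obtain rfl : t = _ := (Category.comp_id t).symm.trans hts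
        rfl
      exact key _ _ _ h h' (toMixedRow_fromMixedRow f φ))

/-- The homotopy from the composition of `f^*` with its inverse to the identity. -/
def homotopyPrecompInv [W.ContainsIdentities] {A B : C} (f : A ⟶ B) (hf : W f) (Y : C) :
    SSet.Homotopy (hammockPrecomp W f Y ≫ hammockPrecompInv W f hf Y) (𝟙 (hammockMap W B Y)) :=
  hammockMap.mkHomotopy
    -- The hammock begins with `B ← R → B`, both arrows being `f` over `0` and the identity over
    -- `1`.
    (fun Δ φ z => .cons (fromMixedRow f φ) (fromMixedRow_mem f hf φ) (fromMixedRow f φ) z)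
    (fun _ _ _ _ h => Quot.sound (.cons _ _ _ h))
    (fun _ _ _ _ _ => rfl)
    (fun Δ φ z hφ => by
      obtain ⟨h, h'⟩ := mixedRow_zero f φ hφ
      have key : ∀ {R : Fin (Δ.unop.len + 1) ⥤ C} (s : R ⟶ constRow Δ.unop.len B)
          (hs : W.functorCategory _ s) (t : constRow _ A ⟶ R) (h : constRow _ A = R),
          t = eqToHom h → t ≫ s = (Functor.const _).map f →
          toClass (.cons s hs s z) =
            toClass (.cons ((Functor.const _).map f) (fun _ => hf) (𝟙 (constRow _ A))
              (Hammock.precomp f z)) := by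
        rintro R s hs t rfl rfl hts
        obtain rfl : s = _ := (Category.id_comp s).symm.trans hts
        refine Eq.trans ?_ (toClass_cons_cons_id _ _ _ _ _ _).symm
        rw [Category.id_comp]
      exact key _ _ _ h h' (toMixedRow_fromMixedRow f φ))
    (fun Δ φ z hφ => by
      obtain ⟨h, h'⟩ := mixedRow_one f φ hφ
      have key : ∀ {R : Fin (Δ.unop.len + 1) ⥤ C} (s : R ⟶ constRow Δ.unop.len B)
          (hs : W.functorCategory _ s) (h : R = constRow _ B), s = eqToHom h →
          toClass (.cons s hs s z) = toClass z := by
        rintro R s hs rfl rfl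
        exact toClass_cons_id_id _ _
      exact key _ _ h h')

/-- The homotopy from the composition of the inverse of `g_*` with `g_*` to the identity. -/
def homotopyInvPostcomp [W.ContainsIdentities] (X : C) {Y Y' : C} (g : Y ⟶ Y') (hg : W g) :
    SSet.Homotopy (hammockPostcompInv W X g hg ≫ hammockPostcomp W X g)
      (𝟙 (hammockMap W X Y')) :=
  hammockMap.mkHomotopy
    (fun Δ φ z => (z.extendRight (𝟙 (constRow _ Y')) (fromMixedRow g φ)
      (fromMixedRow_mem g hg φ)).extendRight (fromMixedRow g φ) (𝟙 (constRow _ Y'))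
      (fun _ => W.id_mem Y'))
    (fun _ _ _ _ h => Quot.sound ((h.extendRight _ _ _).extendRight _ _ _))
    (fun _ _ _ _ _ => congrArg _ ((map_extendRight _ _ _ _ _ _).trans
      (congrArg (OddZigzag.extendRight _ _ _) (map_extendRight _ _ _ _ _ _))))
    (fun Δ φ z hφ => by
      obtain ⟨h, h'⟩ := mixedRow_zero g φ hφ
      have key : ∀ {R : Fin (Δ.unop.len + 1) ⥤ C} (s : R ⟶ constRow Δ.unop.len Y')
          (hs : W.functorCategory _ s) (t : constRow _ Y ⟶ R) (h : constRow _ Y = R),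
          t = eqToHom h → t ≫ s = (Functor.const _).map g →
          toClass ((z.extendRight (𝟙 (constRow _ Y')) s hs).extendRight s (𝟙 (constRow _ Y'))
            (fun _ => W.id_mem Y')) =
          toClass ((z.extendRight (𝟙 (constRow _ Y')) ((Functor.const _).map g)
            (fun _ => hg)).extendRight ((Functor.const _).map g) (𝟙 (constRow _ Y'))
            (fun _ => W.id_mem Y')) := by
        rintro R s hs t rfl rfl hts
        obtain rfl : s = _ := (Category.id_comp s).symm.trans hts
        rfl
      exact key _ _ _ h h' (toMixedRow_fromMixedRow g φ))
    (fun Δ φ z hφ => by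
      obtain ⟨h, h'⟩ := mixedRow_one g φ hφ
      have key : ∀ {R : Fin (Δ.unop.len + 1) ⥤ C} (s : R ⟶ constRow Δ.unop.len Y')
          (hs : W.functorCategory _ s) (h : R = constRow _ Y'), s = eqToHom h →
          toClass ((z.extendRight (𝟙 (constRow _ Y')) s hs).extendRight s (𝟙 (constRow _ Y'))
            (fun _ => W.id_mem Y')) = toClass z := by
        rintro R s hs rfl rfl
        exact (toClass_extendRight_id_id _ _).trans (toClass_extendRight_id_id _ _)
      exact key _ _ h h')

/-- The homotopy from the identity to the composition of `g_*` with its inverse. -/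
def homotopyPostcompInv [W.ContainsIdentities] (X : C) {Y Y' : C} (g : Y ⟶ Y') (hg : W g) :
    SSet.Homotopy (𝟙 (hammockMap W X Y)) (hammockPostcomp W X g ≫ hammockPostcompInv W X g hg) :=
  hammockMap.mkHomotopy
    (fun Δ φ z => z.extendRight (toMixedRow g φ) (toMixedRow g φ) (toMixedRow_mem g hg φ))
    (fun _ _ _ _ h => Quot.sound (h.extendRight _ _ _))
    (fun _ _ _ _ _ => congrArg _ (map_extendRight _ _ _ _ _ _))
    (fun Δ φ z hφ => by
      obtain ⟨h, h'⟩ := mixedRow_zero g φ hφ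
      have key : ∀ {R : Fin (Δ.unop.len + 1) ⥤ C} (t : constRow Δ.unop.len Y ⟶ R)
          (ht : W.functorCategory _ t) (h : constRow Δ.unop.len Y = R), t = eqToHom h →
          toClass (z.extendRight t t ht) = toClass z := by
        rintro R t ht rfl rfl
        exact toClass_extendRight_id_id _ _
      exact key _ _ h h')
    (fun Δ φ z hφ => by
      obtain ⟨h, h'⟩ := mixedRow_one g φ hφ
      have key : ∀ {R : Fin (Δ.unop.len + 1) ⥤ C} (t : constRow Δ.unop.len Y ⟶ R)
          (ht : W.functorCategory _ t) (s : R ⟶ constRow _ Y') (h : R = constRow _ Y'),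
          s = eqToHom h → t ≫ s = (Functor.const _).map g →
          toClass (z.extendRight t t ht) =
            toClass ((z.extendRight ((Functor.const _).map g) (𝟙 (constRow _ Y'))
              (fun _ => W.id_mem Y')).extendRight (𝟙 (constRow _ Y'))
                ((Functor.const _).map g) (fun _ => hg)) := by
        rintro R t ht s rfl rfl hts
        obtain rfl : t = _ := (Category.comp_id t).symm.trans hts
        refine Eq.trans ?_ (toClass_extendRight_extendRight_id _ _ _ _ _
          (by rw [Category.comp_id]; exact fun _ => hg) _).symm
        simp only [Category.comp_id]
      exact key _ _ _ h h' (toMixedRow_fromMixedRow g φ))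

/-- Simplicial homotopies are not symmetric in general, and those above point in different
directions. The hypotheses only involve the induced maps on homotopy classes, where the direction is
irrelevant. -/
lemma IsWeakHomotopyEquivalence.of_homotopies {X Y : SSet.{w}} {f : X ⟶ Y} {g : Y ⟶ X}
    (h : HomotopyClasses.precomp (f ≫ g) = HomotopyClasses.precomp (𝟙 X))
    (h' : HomotopyClasses.precomp (g ≫ f) = HomotopyClasses.precomp (𝟙 Y)) :
    IsWeakHomotopyEquivalence f := by
  intro Z _
  refine Function.bijective_iff_has_inverse.2 ⟨HomotopyClasses.precomp g Z,
    fun z => ?_, fun z => ?_⟩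
  · have := congrFun (congrFun h' Z) z
    rwa [HomotopyClasses.precomp_comp, HomotopyClasses.precomp_id] at this
  · have := congrFun (congrFun h Z) z
    rwa [HomotopyClasses.precomp_comp, HomotopyClasses.precomp_id] at this

lemma isWeakHomotopyEquivalence_hammockPrecomp [W.ContainsIdentities] {A B : C} (f : A ⟶ B)
    (hf : W f) (Y : C) : IsWeakHomotopyEquivalence (hammockPrecomp W f Y) :=
  .of_homotopies (g := hammockPrecompInv W f hf Y)
    (funext fun _ => HomotopyClasses.precomp_eq_of_homotopy (homotopyPrecompInv W f hf Y) _)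
    (funext fun _ =>
      (HomotopyClasses.precomp_eq_of_homotopy (homotopyInvPrecomp W f hf Y) _).symm)

lemma isWeakHomotopyEquivalence_hammockPostcomp [W.ContainsIdentities] (X : C) {Y Y' : C}
    (g : Y ⟶ Y') (hg : W g) : IsWeakHomotopyEquivalence (hammockPostcomp W X g) :=
  .of_homotopies (g := hammockPostcompInv W X g hg)
    (funext fun _ =>
      (HomotopyClasses.precomp_eq_of_homotopy (homotopyPostcompInv W X g hg) _).symm)
    (funext fun _ => HomotopyClasses.precomp_eq_of_homotopy (homotopyInvPostcomp W X g hg) _)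

end

/-! ### Functoriality with respect to functors which preserve weak equivalences -/

section

open OddZigzag Simplicial

variable {C : Type u} [Category.{v} C] (W : MorphismProperty C)

/-- The comparison map from the constant row on `F X` to the image under `F` of the constant
row on `X`. -/
def constRowToMap (F : C ⥤ C) (k : ℕ) (X : C) :
    constRow k (F.obj X) ⟶ ((Functor.whiskeringRight _ _ _).obj F).obj (constRow k X) where
  app _ := 𝟙 (F.obj X)

/-- The comparison map from the image under `F` of the constant row on `X` to the constant
row on `F X`. -/
def mapToConstRow (F : C ⥤ C) (k : ℕ) (X : C) :
    ((Functor.whiskeringRight _ _ _).obj F).obj (constRow k X) ⟶ constRow k (F.obj X) where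
  app _ := 𝟙 (F.obj X)

lemma constRowToMap_naturality (F : C ⥤ C) (k : ℕ) {X Y : C} (f : X ⟶ Y) :
    constRowToMap F k X ≫ ((Functor.whiskeringRight _ _ _).obj F).map ((Functor.const _).map f) =
      (Functor.const _).map (F.map f) ≫ constRowToMap F k Y := by
  ext j
  simp [constRowToMap]

lemma whiskeringRight_map_mem {F : C ⥤ C} (hF : ∀ ⦃A B : C⦄ (f : A ⟶ B), W f → W (F.map f))
    (k : ℕ) ⦃A B : Fin (k + 1) ⥤ C⦄ (f : A ⟶ B) (hf : W.functorCategory (Fin (k + 1)) f) :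
    W.functorCategory (Fin (k + 1)) (((Functor.whiskeringRight _ _ _).obj F).map f) :=
  fun j => hF _ (hf j)

variable {W}

lemma OddZigzag.map_rowFunctor_whiskeringRight {F : C ⥤ C}
    (hF : ∀ ⦃A B : C⦄ (f : A ⟶ B), W f → W (F.map f)) {Δ Δ' : SimplexCategoryᵒᵖ} (ψ : Δ ⟶ Δ')
    {X Y : Fin (Δ.unop.len + 1) ⥤ C}
    (z : OddZigzag (W.functorCategory (Fin (Δ.unop.len + 1))) Y X) :
    OddZigzag.map (rowFunctor C ψ) (rowFunctor_map_mem W ψ)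
        (z.map _ (whiskeringRight_map_mem W hF _)) =
      OddZigzag.map ((Functor.whiskeringRight _ _ _).obj F) (whiskeringRight_map_mem W hF _)
        (z.map (rowFunctor C ψ) (rowFunctor_map_mem W ψ)) := by
  induction z with
  | last d hd => rfl
  | cons d hd e z ih => exact congrArg (OddZigzag.cons _ _ _) ih

/-- The map `L^H C(X, Y) ⟶ L^H C(F X, F Y)` induced by a functor `F` which preserves the
distinguished class of morphisms. -/
def hammockFunctor [W.ContainsIdentities] {F : C ⥤ C}
    (hF : ∀ ⦃A B : C⦄ (f : A ⟶ B), W f → W (F.map f)) (X Y : C) :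
    hammockMap W X Y ⟶ hammockMap W (F.obj X) (F.obj Y) :=
  hammockMap.mkHom
    -- The columns added at both ends consist of identities; they connect the constant row on `F X`
    -- with the image under `F` of the constant row on `X`.
    (fun _ z => .cons (𝟙 (constRow _ (F.obj X))) (fun _ => W.id_mem _) (constRowToMap F _ X)
      ((z.map _ (whiskeringRight_map_mem W hF _)).extendRight (mapToConstRow F _ Y)
        (𝟙 (constRow _ (F.obj Y))) (fun _ => W.id_mem _)))
    (fun _ _ _ h => Quot.sound (.cons _ _ _ ((h.map _ _).extendRight _ _ _)))
    (fun _ _ ψ z => congrArg (fun z => toClass (.cons _ _ _ z)) ((map_extendRight _ _ _ _ _ _).trans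
      (congrArg (OddZigzag.extendRight _ _ _) (map_rowFunctor_whiskeringRight hF ψ z))))

/-- Omitting the inner backward identity on each side leaves composed forward columns, which agree
by naturality of `constRowToMap`. -/
lemma hammockPrecomp_hammockFunctor [W.ContainsIdentities] {F : C ⥤ C}
    (hF : ∀ ⦃A B : C⦄ (f : A ⟶ B), W f → W (F.map f)) {A B : C} (f : A ⟶ B) (Y : C) :
    hammockPrecomp W f Y ≫ hammockFunctor hF A Y =
      hammockFunctor hF B Y ≫ hammockPrecomp W (F.map f) (F.obj Y) := by
  refine hammockMap.hom_ext fun Δ z => ?_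
  have key : ∀ {R : Fin (Δ.unop.len + 1) ⥤ C} (d : R ⟶ R) (hd : W.functorCategory _ d)
      (hd' : d = 𝟙 R) {R' : Fin (Δ.unop.len + 1) ⥤ C} (t : constRow Δ.unop.len (F.obj A) ⟶ R)
      (s : R ⟶ R') (r : constRow Δ.unop.len (F.obj B) ⟶ R')
      (z' : OddZigzag (W.functorCategory _) (constRow Δ.unop.len (F.obj Y)) R')
      (h : t ≫ s = (Functor.const _).map (F.map f) ≫ r),
      toClass (.cons (𝟙 _) (fun _ => W.id_mem _) t (.cons d hd s z')) =
        toClass (Hammock.precomp (F.map f) (.cons (𝟙 _) (fun _ => W.id_mem _) r z')) := by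
    rintro R d hd rfl R' t s r z' h
    refine (toClass_cons_cons_id _ _ _ _ _ _).trans (Eq.trans ?_
      (toClass_cons_cons_id _ _ _ _ _ _).symm)
    rw [h]
  exact key _ _ (by ext; simp) _ _ _ _ (constRowToMap_naturality F _ f)

lemma hammockPrecomp_comp [W.ContainsIdentities] {A B D : C} (f : A ⟶ B) (g : B ⟶ D) (Y : C) :
    hammockPrecomp W (f ≫ g) Y = hammockPrecomp W g Y ≫ hammockPrecomp W f Y := by
  refine hammockMap.hom_ext fun Δ z => ?_
  refine Eq.trans ?_ (toClass_cons_cons_id _ _ _ _ _ _).symm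
  exact congrArg toClass (cons_congr _ _ _ rfl (Functor.map_comp _ _ _))

lemma hammockPrecomp_hammockPostcomp [W.ContainsIdentities] {A B : C} (f : A ⟶ B) {X Y : C}
    (g : X ⟶ Y) :
    hammockPrecomp W f X ≫ hammockPostcomp W A g = hammockPostcomp W B g ≫ hammockPrecomp W f Y :=
  hammockMap.hom_ext fun _ _ => rfl

end

/-! ### Diagrams of endofunctors applied objectwise -/

section

variable {J : Type u'} [Category.{v'} J] {C : Type u} [Category.{v} C]

/-- The functor `(J ⥤ C) ⥤ (J ⥤ C)` which applies objectwise a diagram of endofunctors of `C`. -/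
@[simps]
def diagonalFunctor (G : J ⥤ C ⥤ C) : (J ⥤ C) ⥤ (J ⥤ C) where
  obj Z :=
    { obj j := (G.obj j).obj (Z.obj j)
      map {i j} g := (G.map g).app _ ≫ (G.obj j).map (Z.map g) }
  map {Z Z'} f :=
    { app j := (G.obj j).map (f.app j)
      naturality i j g := by
        simp [← Functor.map_comp] }

/-- The natural transformation from the identity to `diagonalFunctor G` given by a map from
the constant diagram. -/
@[simps]
def toDiagonalFunctor {G : J ⥤ C ⥤ C} (α : (Functor.const J).obj (𝟭 C) ⟶ G) :
    𝟭 (J ⥤ C) ⟶ diagonalFunctor G where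
  app Z :=
    { app j := (α.app j).app (Z.obj j)
      naturality i j g := by
        have h := NatTrans.congr_app (α.naturality g) (Z.obj i)
        have h' := (α.app j).naturality (Z.map g)
        dsimp at h h' ⊢
        rw [Category.id_comp] at h
        exact h'.trans ((congrArg (· ≫ (G.obj j).map (Z.map g)) h).trans (Category.assoc _ _ _)) }
  naturality Z Z' f := by
    ext j
    exact (α.app j).naturality (f.app j)

/-- The natural transformation from `diagonalFunctor G` to the postcomposition with `F` given
by a map to the constant diagram. -/
@[simps]
def fromDiagonalFunctor {G : J ⥤ C ⥤ C} {F : C ⥤ C} (β : G ⟶ (Functor.const J).obj F) :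
    diagonalFunctor G ⟶ (Functor.whiskeringRight _ _ _).obj F where
  app Z :=
    { app j := (β.app j).app (Z.obj j)
      naturality i j g := by
        have h := NatTrans.congr_app (β.naturality g) (Z.obj i)
        have h' := (β.app j).naturality (Z.map g)
        dsimp at h h' ⊢
        rw [Category.comp_id] at h
        exact (Category.assoc _ _ _).trans
          ((congrArg ((G.map g).app (Z.obj i) ≫ ·) h').trans
            ((Category.assoc _ _ _).symm.trans (congrArg (· ≫ F.map (Z.map g)) h))) }
  naturality Z Z' f := by
    ext j
    exact (β.app j).naturality (f.app j)

lemma toDiagonalFunctor_fromDiagonalFunctor {G : J ⥤ C ⥤ C} {F : C ⥤ C}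
    (α : (Functor.const J).obj (𝟭 C) ⟶ G) (β : G ⟶ (Functor.const J).obj F) {τ : 𝟭 C ⟶ F}
    (h : α ≫ β = (Functor.const J).map τ) (Z : J ⥤ C) :
    (toDiagonalFunctor α).app Z ≫ (fromDiagonalFunctor β).app Z =
      ((Functor.whiskeringLeft _ _ _).obj Z).map τ := by
  ext j
  exact congrArg (fun f => NatTrans.app f (Z.obj j)) (NatTrans.congr_app h j)

lemma toDiagonalFunctor_eq_eqToHom {G : J ⥤ C ⥤ C} (α : (Functor.const J).obj (𝟭 C) ⟶ G)
    (h : (Functor.const J).obj (𝟭 C) = G) (h' : α = eqToHom h) :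
    ∃ h : 𝟭 (J ⥤ C) = diagonalFunctor G, toDiagonalFunctor α = eqToHom h := by
  subst h h'
  refine NatTrans.eq_eqToHom _ fun Z => NatTrans.eq_eqToHom _ fun j => ⟨rfl, rfl⟩

lemma fromDiagonalFunctor_eq_eqToHom {G : J ⥤ C ⥤ C} {F : C ⥤ C}
    (β : G ⟶ (Functor.const J).obj F) (h : G = (Functor.const J).obj F) (h' : β = eqToHom h) :
    ∃ h : diagonalFunctor G = (Functor.whiskeringRight _ _ _).obj F,
      fromDiagonalFunctor β = eqToHom h := by
  subst h h'
  refine NatTrans.eq_eqToHom _ fun Z => NatTrans.eq_eqToHom _ fun j => ⟨rfl, rfl⟩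

end

/-! ### The homotopy induced by a natural transformation from the identity -/

section

open OddZigzag Simplicial

variable {C : Type u} [Category.{v} C] {W : MorphismProperty C}

lemma diagonalFunctor_map_mem {F : C ⥤ C} (hF : ∀ ⦃A B : C⦄ (f : A ⟶ B), W f → W (F.map f))
    (τ : 𝟭 C ⟶ F) {Δ : SimplexCategory} (φ : Δ ⟶ ⦋1⦌) ⦃A B : Fin (Δ.len + 1) ⥤ C⦄ (f : A ⟶ B)
    (hf : W.functorCategory (Fin (Δ.len + 1)) f) :
    W.functorCategory (Fin (Δ.len + 1)) ((diagonalFunctor (mixedRow τ φ)).map f) := by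
  intro j
  have key : ∀ i : Fin 2, W (((ComposableArrows.mk₁ τ).obj i).map (f.app j)) := by
    intro i
    match i with
    | 0 => exact hf j
    | 1 => exact hF _ (hf j)
  exact key _

lemma OddZigzag.map_rowFunctor_diagonalFunctor {F : C ⥤ C}
    (hF : ∀ ⦃A B : C⦄ (f : A ⟶ B), W f → W (F.map f)) (τ : 𝟭 C ⟶ F)
    {Δ Δ' : SimplexCategoryᵒᵖ} (ψ : Δ ⟶ Δ') (φ : Δ.unop ⟶ ⦋1⦌)
    {X Y : Fin (Δ.unop.len + 1) ⥤ C}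
    (z : OddZigzag (W.functorCategory (Fin (Δ.unop.len + 1))) Y X) :
    OddZigzag.map (rowFunctor C ψ) (rowFunctor_map_mem W ψ)
        (z.map _ (diagonalFunctor_map_mem hF τ φ)) =
      OddZigzag.map (diagonalFunctor (mixedRow τ (ψ.unop ≫ φ)))
        (diagonalFunctor_map_mem hF τ (ψ.unop ≫ φ))
        (z.map (rowFunctor C ψ) (rowFunctor_map_mem W ψ)) := by
  induction z with
  | last d hd => rfl
  | cons d hd e z ih => exact congrArg (OddZigzag.cons _ _ _) ih

lemma OddZigzag.map_id {Y : C} (h : ∀ ⦃A B : C⦄ (f : A ⟶ B), W f → W ((𝟭 C).map f))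
    {X : C} (z : OddZigzag W Y X) : z.map (𝟭 C) h = z := by
  induction z with
  | last d hd => rfl
  | cons d hd e z ih => exact congrArg (OddZigzag.cons _ _ _) ih

/-- Given `τ : 𝟭 C ⟶ F`, the homotopy from `(τ_X)_*` to the composition of the map induced by `F`
and of `(τ_A)^*`. -/
def homotopyPostcompHammockFunctor [W.ContainsIdentities] {F : C ⥤ C}
    (hF : ∀ ⦃A B : C⦄ (f : A ⟶ B), W f → W (F.map f)) (τ : 𝟭 C ⟶ F) (A X : C) :
    SSet.Homotopy (hammockPostcomp W A (τ.app X))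
      (hammockFunctor hF A X ≫ hammockPrecomp W (τ.app A) (F.obj X)) :=
  hammockMap.mkHomotopy
    -- `F` is applied only to the rows over `1`, and `τ` gives the vertical maps across the jump.
    -- Over `0` the row ends with `τ_X`, giving `(τ_X)_*`; over `1` it begins with `τ_A` followed by
    -- `F z`.
    (fun Δ φ z => .cons (𝟙 (constRow _ A)) (fun _ => W.id_mem _)
      ((toDiagonalFunctor (toMixedRow τ φ)).app (constRow _ A))
      ((z.map _ (diagonalFunctor_map_mem hF τ φ)).extendRight
        ((fromDiagonalFunctor (fromMixedRow τ φ)).app (constRow _ X) ≫ mapToConstRow F _ X)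
        (𝟙 (constRow _ (F.obj X))) (fun _ => W.id_mem _)))
    (fun _ _ _ _ h => Quot.sound (.cons _ _ _ ((h.map _ _).extendRight _ _ _)))
    (fun _ _ ψ φ z => congrArg (fun z => toClass (.cons _ _ _ z))
      ((map_extendRight _ _ _ _ _ _).trans
        (congrArg (OddZigzag.extendRight _ _ _) (map_rowFunctor_diagonalFunctor hF τ ψ φ z))))
    (fun Δ φ z hφ => by
      obtain ⟨h, h'⟩ := mixedRow_zero τ φ hφ
      obtain ⟨h, h'⟩ := toDiagonalFunctor_eq_eqToHom _ h h'
      have key : ∀ {H : (Fin (Δ.unop.len + 1) ⥤ C) ⥤ (Fin (Δ.unop.len + 1) ⥤ C)}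
          (hH : ∀ ⦃A B⦄ (f : A ⟶ B), W.functorCategory (Fin (Δ.unop.len + 1)) f →
            W.functorCategory (Fin (Δ.unop.len + 1)) (H.map f))
          (α : 𝟭 _ ⟶ H) (β : H ⟶ (Functor.whiskeringRight _ _ _).obj F) (h : 𝟭 _ = H),
          α = eqToHom h → (∀ Z, α.app Z ≫ β.app Z = ((Functor.whiskeringLeft _ _ _).obj Z).map τ) →
          toClass (.cons (𝟙 (constRow _ A)) (fun _ => W.id_mem _) (α.app (constRow _ A))
            ((z.map H hH).extendRight (β.app (constRow _ X) ≫ mapToConstRow F _ X)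
              (𝟙 (constRow _ (F.obj X))) (fun _ => W.id_mem _))) =
          toClass (z.extendRight ((Functor.const _).map (τ.app X)) (𝟙 (constRow _ (F.obj X)))
            (fun _ => W.id_mem _)) := by
        rintro H hH α β rfl rfl hαβ
        refine (toClass_cons_id_id _ _).trans ?_
        rw [OddZigzag.map_id]
        refine congrArg toClass (extendRight_congr _ _ _ ?_ rfl)
        ext j
        have h := NatTrans.congr_app (hαβ (constRow _ X)) j
        refine (Category.comp_id _).trans (Eq.trans ?_ h)
        exact (Category.id_comp _).symm
      exact key _ _ _ h h' (toDiagonalFunctor_fromDiagonalFunctor _ _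
        (toMixedRow_fromMixedRow τ φ)))
    (fun Δ φ z hφ => by
      obtain ⟨h, h'⟩ := mixedRow_one τ φ hφ
      obtain ⟨h, h'⟩ := fromDiagonalFunctor_eq_eqToHom _ h h'
      have key : ∀ {H : (Fin (Δ.unop.len + 1) ⥤ C) ⥤ (Fin (Δ.unop.len + 1) ⥤ C)}
          (hH : ∀ ⦃A B⦄ (f : A ⟶ B), W.functorCategory (Fin (Δ.unop.len + 1)) f →
            W.functorCategory (Fin (Δ.unop.len + 1)) (H.map f))
          (α : 𝟭 _ ⟶ H) (β : H ⟶ (Functor.whiskeringRight _ _ _).obj F)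
          (h : H = (Functor.whiskeringRight _ _ _).obj F),
          β = eqToHom h → (∀ Z, α.app Z ≫ β.app Z = ((Functor.whiskeringLeft _ _ _).obj Z).map τ) →
          toClass (.cons (𝟙 (constRow _ A)) (fun _ => W.id_mem _) (α.app (constRow _ A))
            ((z.map H hH).extendRight (β.app (constRow _ X) ≫ mapToConstRow F _ X)
              (𝟙 (constRow _ (F.obj X))) (fun _ => W.id_mem _))) =
          toClass (Hammock.precomp (τ.app A)
            (.cons (𝟙 (constRow _ (F.obj A))) (fun _ => W.id_mem _) (constRowToMap F _ A)
              ((z.map _ (whiskeringRight_map_mem W hF _)).extendRight (mapToConstRow F _ X)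
                (𝟙 (constRow _ (F.obj X))) (fun _ => W.id_mem _)))) := by
        rintro H hH α β rfl rfl hαβ
        refine Eq.trans (congrArg toClass ?_) (toClass_cons_cons_id _ _ _ _ _ _).symm
        have e : α.app (constRow _ A) =
            (Functor.const _).map (τ.app A) ≫ constRowToMap F _ A := by
          ext j
          have h := NatTrans.congr_app (hαβ (constRow _ A)) j
          refine ((Category.comp_id _).symm.trans h).trans ?_
          exact (Category.comp_id _).symm
        refine (cons_congr _ _ _ rfl e).trans (congrArg (OddZigzag.cons _ _ _) ?_)
        exact extendRight_congr _ _ _ (Category.id_comp _) rfl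
      exact key _ _ _ h h' (toDiagonalFunctor_fromDiagonalFunctor _ _
        (toMixedRow_fromMixedRow τ φ)))

end

/-! ### Evaluation of hammocks in the homotopy category -/

section

variable {C : Type u} [Category.{v} C] {W : MorphismProperty C}

/-- The morphism in the localized category given by a zigzag. -/
noncomputable def OddZigzag.eval {Y : C} : ∀ {X : C}, OddZigzag W Y X → (W.Q.obj X ⟶ W.Q.obj Y)
  | _, last d hd => have := Localization.inverts W.Q W d hd; inv (W.Q.map d)
  | _, cons d hd e z => have := Localization.inverts W.Q W d hd
    inv (W.Q.map d) ≫ W.Q.map e ≫ eval z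

lemma OddZigzag.Reduction.eval_eq {X Y : C} {z z' : OddZigzag W Y X} (h : Reduction z z') :
    z.eval = z'.eval := by
  have inst : ∀ {A B : C} (d : A ⟶ B), W d → IsIso (W.Q.map d) :=
    fun d hd => Localization.inverts W.Q W d hd
  induction h with
  | forward_last d hd d' hd' h =>
    have := inst _ hd; have := inst _ hd'; have := inst _ h
    simp [eval]
  | forward d hd d' hd' h e z =>
    have := inst _ hd; have := inst _ hd'; have := inst _ h
    simp [eval]
  | backward d hd e h e' z =>
    have := inst _ hd
    simp [eval]
  | cons d hd e h ih => simp [eval, ih]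

lemma OddZigzag.eval_extendRight {X Y Y' : C} (e : Y ⟶ Y') (h : W (𝟙 Y'))
    (z : OddZigzag W Y X) : (z.extendRight e (𝟙 Y') h).eval = z.eval ≫ W.Q.map e := by
  induction z with
  | last d hd => simp [extendRight, eval]
  | cons d hd e z ih => simp [extendRight, eval, ih]

/-- Each square of a ladder still commutes after its backward arrows are inverted. When the outer
vertical maps are identities, adjacent rows therefore have the same evaluation, which makes `eval`
well defined on components. -/
lemma OddZigzag.eval_naturality {J : Type u'} [Category.{v'} J] {X Y : J ⥤ C}
    (z : OddZigzag (W.functorCategory J) Y X) {i j : J} (f : i ⟶ j) :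
    (z.map ((evaluation J C).obj i) (fun _ _ _ h => h i)).eval ≫ W.Q.map (Y.map f) =
      W.Q.map (X.map f) ≫ (z.map ((evaluation J C).obj j) (fun _ _ _ h => h j)).eval := by
  have inst : ∀ {A B : C} (d : A ⟶ B), W d → IsIso (W.Q.map d) :=
    fun d hd => Localization.inverts W.Q W d hd
  induction z with
  | last d hd =>
    have := inst _ (hd i); have := inst _ (hd j)
    simp only [OddZigzag.map, eval, evaluation_obj_map]
    rw [IsIso.inv_comp_eq, ← Category.assoc, IsIso.eq_comp_inv, ← Functor.map_comp,
      ← Functor.map_comp, d.naturality]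
  | cons d hd e z ih =>
    have := inst _ (hd i); have := inst _ (hd j)
    simp only [OddZigzag.map, eval, evaluation_obj_map, Category.assoc] at ih ⊢
    rw [ih, IsIso.inv_comp_eq]
    simp only [← Category.assoc]
    congr 1
    simp only [evaluation_obj_obj, Category.assoc]
    rw [← Functor.map_comp, ← e.naturality, Functor.map_comp, ← Functor.map_comp_assoc,
      ← d.naturality, Functor.map_comp, Category.assoc, IsIso.hom_inv_id_assoc]

open Simplicial

/-- The map `L^H C(X, Y)_0 → Hom(X, Y)` with values in the morphisms of the localized category. -/
noncomputable def hammockMap.eval₀ {X Y : C} :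
    (hammockMap W X Y).obj (op ⦋0⦌) → (W.Q.obj X ⟶ W.Q.obj Y) :=
  Quot.lift
    (fun z : Hammock W 0 X Y => (z.map ((evaluation _ C).obj 0) (fun _ _ _ h => h 0)).eval)
    (fun _ _ h => (h.map _ _).eval_eq)

lemma OddZigzag.map_evaluation_pull {X Y : C} {Δ : SimplexCategoryᵒᵖ} (φ : Δ ⟶ op ⦋0⦌)
    (z : Hammock W Δ.unop.len X Y) :
    (Hammock.pull φ z).map (W' := W) ((evaluation _ C).obj 0) (fun _ _ _ h => h 0) =
      z.map ((evaluation _ C).obj (φ.unop.toOrderHom 0)) (fun _ _ _ h => h _) := by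
  have : ∀ {X Y : Fin (Δ.unop.len + 1) ⥤ C} (z : OddZigzag (W.functorCategory _) Y X),
      (OddZigzag.map (rowFunctor C φ) (rowFunctor_map_mem W φ) z).map (W' := W)
        ((evaluation _ C).obj 0) (fun _ _ _ h => h 0) =
      z.map ((evaluation _ C).obj (φ.unop.toOrderHom 0)) (fun _ _ _ h => h _) := by
    intro X Y z
    induction z with
    | last d hd => rfl
    | cons d hd e z ih => exact congrArg (OddZigzag.cons _ _ _) ih
  exact this z

/-- The map `π₀ L^H C(X, Y) → Hom(X, Y)` with values in the morphisms of the localized category. -/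
noncomputable def hammockMap.eval {X Y : C} :
    SSet.π₀ (hammockMap W X Y) → (W.Q.obj X ⟶ W.Q.obj Y) :=
  SSet.π₀.lift eval₀ (by
    intro x₀ x₁ e
    obtain ⟨z, hz⟩ := Quot.exists_rep e.edge
    have h₀ := e.src_eq
    have h₁ := e.tgt_eq
    rw [← hz] at h₀ h₁
    rw [← h₀, ← h₁]
    have n := OddZigzag.eval_naturality z (homOfLE (Fin.zero_le 1) : (0 : Fin 2) ⟶ 1)
    have r₀ := congrArg OddZigzag.eval
      (OddZigzag.map_evaluation_pull (SimplexCategory.δ (1 : Fin 2)).op z)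
    have r₁ := congrArg OddZigzag.eval
      (OddZigzag.map_evaluation_pull (SimplexCategory.δ (0 : Fin 2)).op z)
    refine r₀.trans (Eq.trans ?_ r₁.symm)
    refine Eq.trans ?_ (n.trans ?_)
    · exact ((congrArg (_ ≫ ·) (W.Q.map_id Y)).trans (Category.comp_id _)).symm
    · exact (congrArg (· ≫ _) (W.Q.map_id X)).trans (Category.id_comp _))

lemma hammockMap.eval_precomp [W.ContainsIdentities] {A B : C} (f : A ⟶ B) {Y : C}
    (x : SSet.π₀ (hammockMap W B Y)) :
    eval (SSet.mapπ₀ (hammockPrecomp W f Y) x) = W.Q.map f ≫ eval x := by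
  obtain ⟨x, rfl⟩ := x.mk_surjective
  obtain ⟨z, rfl⟩ := Quot.exists_rep x
  have h : inv (W.Q.map (𝟙 A)) = 𝟙 _ := by simp
  exact (congrArg (· ≫ W.Q.map f ≫ _) h).trans (Category.id_comp _)

lemma hammockMap.eval_postcomp [W.ContainsIdentities] {X Y Y' : C} (g : Y ⟶ Y')
    (x : SSet.π₀ (hammockMap W X Y)) :
    eval (SSet.mapπ₀ (hammockPostcomp W X g) x) = eval x ≫ W.Q.map g := by
  obtain ⟨x, rfl⟩ := x.mk_surjective
  obtain ⟨z, rfl⟩ := Quot.exists_rep x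
  exact (congrArg OddZigzag.eval (OddZigzag.map_extendRight _ _ _ _ _ _)).trans
    (OddZigzag.eval_extendRight _ _ _)

/-- The class of the identity in `π₀ L^H C(X, X)`. -/
def hammockMap.idClass (W : MorphismProperty C) [W.ContainsIdentities] (X : C) :
    SSet.π₀ (hammockMap W X X) :=
  SSet.π₀.mk (Quot.mk _ (.last (𝟙 (constRow 0 X)) (fun _ => W.id_mem X)))

lemma hammockMap.eval_idClass [W.ContainsIdentities] (X : C) :
    eval (idClass W X) = 𝟙 (W.Q.obj X) := by
  have h : inv (W.Q.map (𝟙 X)) = 𝟙 _ := by simp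
  exact h

/-- Both sides are represented by `A ← A → B ← B`, with `f` in the middle. -/
lemma hammockMap.precomp_idClass [W.ContainsIdentities] {A B : C} (f : A ⟶ B) :
    SSet.mapπ₀ (hammockPrecomp W f B) (idClass W B) =
      SSet.mapπ₀ (hammockPostcomp W A f) (idClass W A) :=
  rfl

/-- Surjectivity gives `g` with `f^* g = id_A`. Then `f^* (f_* g) = f_* (f^* g) = f_* id_A = f^*
id_B`, so `f_* g = id_B` by injectivity; evaluation makes `g` a two-sided inverse. -/
lemma isIso_Q_map_of_hammockPrecomp [W.ContainsIdentities] {A B : C} (f : A ⟶ B)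
    (hA : Function.Surjective (SSet.mapπ₀ (hammockPrecomp W f A)))
    (hB : Function.Injective (SSet.mapπ₀ (hammockPrecomp W f B))) :
    IsIso (W.Q.map f) := by
  obtain ⟨g, hg⟩ := hA (hammockMap.idClass W A)
  refine ⟨hammockMap.eval g, ?_, ?_⟩
  · rw [← hammockMap.eval_precomp, hg, hammockMap.eval_idClass]
  · rw [← hammockMap.eval_postcomp, ← hammockMap.eval_idClass]
    congr 1
    apply hB
    rw [hammockMap.precomp_idClass, ← hg, ← SSet.mapπ₀_comp_apply, ← SSet.mapπ₀_comp_apply,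
      hammockPrecomp_hammockPostcomp]

end

/-! ### Homotopy idempotent functors -/

section

variable {C : Type u} [Category.{v} C] {W : MorphismProperty C}

/-- If `F` is a functor which preserves the distinguished class of morphisms, `τ : 𝟭 C ⟶ F` and
`τ_X` is in the class, then `f^*` is a retract of `(F f)^*` up to homotopy, for maps to `X`. -/
lemma isWeakHomotopyEquivalence_of_map [W.ContainsIdentities] {F : C ⥤ C}
    (hF : ∀ ⦃A B : C⦄ (f : A ⟶ B), W f → W (F.map f)) (τ : 𝟭 C ⟶ F) {X : C}
    (hX : W (τ.app X)) {A B : C} (f : A ⟶ B) (hf : W (F.map f)) :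
    IsWeakHomotopyEquivalence (hammockPrecomp W f X) := by
  intro Z hZ
  have hf' := isWeakHomotopyEquivalence_hammockPrecomp W _ hf (F.obj X) Z hZ
  have hw : ∀ D : C, Function.Bijective
      (HomotopyClasses.precomp (hammockFunctor hF D X) Z ∘
        HomotopyClasses.precomp (hammockPrecomp W (τ.app D) (F.obj X)) Z) := by
    intro D
    rw [← HomotopyClasses.precomp_comp, ← HomotopyClasses.precomp_eq_of_homotopy
      (homotopyPostcompHammockFunctor hF τ D X)]
    exact isWeakHomotopyEquivalence_hammockPostcomp W D _ hX Z hZ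
  have e₁ := congrArg (HomotopyClasses.precomp · Z) (hammockPrecomp_hammockFunctor hF f X)
  have e₂ : HomotopyClasses.precomp (hammockPrecomp W (F.map f) (F.obj X) ≫
        hammockPrecomp W (τ.app A) (F.obj X)) Z =
      HomotopyClasses.precomp (hammockPrecomp W (τ.app B) (F.obj X) ≫
        hammockPrecomp W f (F.obj X)) Z := by
    rw [← hammockPrecomp_comp, ← hammockPrecomp_comp, ← τ.naturality]
    rfl
  have e₃ := congrArg (HomotopyClasses.precomp · Z) (hammockPrecomp_hammockPostcomp (W := W) f
    (τ.app X))
  rw [HomotopyClasses.precomp_comp, HomotopyClasses.precomp_comp] at e₁ e₂ e₃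
  have hp : ∀ D : C, Function.Bijective
      (HomotopyClasses.precomp (hammockPostcomp W D (τ.app X)) Z) := fun D =>
    isWeakHomotopyEquivalence_hammockPostcomp W D _ hX Z hZ
  constructor
  -- Injectivity is first obtained for maps to `F X`, by cancelling `(τ_B)^*` in `e₂`, and then
  -- carried to `X` along `(τ_X)_*`.
  · have h : Function.Injective (HomotopyClasses.precomp (hammockPrecomp W f (F.obj X)) Z) := by
      have h' := hf'.1.comp (hw A).1.of_comp
      rw [e₂] at h'
      exact h'.of_comp
    have h' := (hp B).1.comp h
    rw [← e₃] at h'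
    exact h'.of_comp_right (hp A).2
  -- Surjectivity comes directly from the square `e₁`: the action of `F` on maps out of `B` is
  -- surjective on homotopy classes.
  · have h := (hw B).2.of_comp.comp hf'.2
    rw [← e₁] at h
    exact h.of_comp

end

/-! ### Local objects and local equivalences in a model category -/

section

variable {M : Type u} [Category.{v} M] [ModelCategory M]

lemma simpliciallyOrthogonal_iff_of_weakEquivalence {A B X Y : M} (f : A ⟶ B) (g : X ⟶ Y)
    (hg : weakEquivalences M g) :
    SimpliciallyOrthogonal f X ↔ SimpliciallyOrthogonal f Y := by
  refine forall_congr' fun Z => forall_congr' fun hZ => ?_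
  have e := congrArg (HomotopyClasses.precomp · Z)
    (hammockPrecomp_hammockPostcomp (W := weakEquivalences M) f g)
  rw [HomotopyClasses.precomp_comp, HomotopyClasses.precomp_comp] at e
  have hA := isWeakHomotopyEquivalence_hammockPostcomp (weakEquivalences M) A g hg Z hZ
  have hB := isWeakHomotopyEquivalence_hammockPostcomp (weakEquivalences M) B g hg Z hZ
  rw [← hA.of_comp_iff, e, hB.of_comp_iff']

lemma exists_fibrant_weakEquivalence (X : M) :
    ∃ (Y : M) (g : X ⟶ Y), IsFibrant Y ∧ weakEquivalences M g := by
  obtain ⟨Y, h, g, _, hg⟩ := FibrantObject.HoCat.exists_resolution X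
  exact ⟨Y, g, h, by rwa [← weakEquivalence_iff]⟩

namespace IsHomotopyIdempotent

variable {L : M ⥤ M} {ℓ : 𝟭 M ⟶ L}

lemma unit_mem_iff (hL : IsHomotopyIdempotent L ℓ)
    {A B : M} (f : A ⟶ B) (hf : weakEquivalences M f) :
    weakEquivalences M (ℓ.app A) ↔ weakEquivalences M (ℓ.app B) := by
  have h := ℓ.naturality f
  have hf' := hL.map_mem f hf
  dsimp only [Functor.id_obj, Functor.id_map] at h
  rw [← weakEquivalence_iff] at hf hf' ⊢
  rw [← weakEquivalence_iff, ← weakEquivalence_postcomp_iff _ (L.map f), ← h,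
    weakEquivalence_precomp_iff]

lemma unit_mem_of_weaklyEquivalent (hL : IsHomotopyIdempotent L ℓ)
    {X Y : M} (h : WeaklyEquivalent X (L.obj Y)) :
    weakEquivalences M (ℓ.app X) := by
  have key : ∀ {A B : M}, WeaklyEquivalent A B →
      (weakEquivalences M (ℓ.app A) ↔ weakEquivalences M (ℓ.app B)) := by
    intro A B h
    induction h with
    | rel A B h => obtain ⟨f, hf⟩ := h; exact hL.unit_mem_iff f hf
    | refl A => rfl
    | symm A B _ ih => exact ih.symm
    | trans A B C _ _ ih ih' => exact ih.trans ih'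
  exact (key h).2 (hL.unit_obj_mem Y)

lemma simpliciallyOrthogonal (hL : IsHomotopyIdempotent L ℓ)
    {A B X : M} (f : A ⟶ B) (hf : localEquivalences L f)
    (hX : weakEquivalences M (ℓ.app X)) : SimpliciallyOrthogonal f X :=
  isWeakHomotopyEquivalence_of_map hL.map_mem ℓ hX f hf

/-- Both `f` and the units are orthogonal to every `L Y`, so the naturality square of `ℓ` transfers
bijectivity on `π₀` to `L f`. The cases `Y = A` and `Y = B` suffice for the Yoneda argument. -/
lemma mem_localEquivalences_of_orthogonal (hL : IsHomotopyIdempotent L ℓ) {A B : M} (f : A ⟶ B)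
    (hf : orthogonalMorphisms (localObjects L) f) : localEquivalences L f := by
  have h : ∀ Y : M, Function.Bijective
      (SSet.mapπ₀ (hammockPrecomp (weakEquivalences M) (L.map f) (L.obj Y))) := by
    intro Y
    have h₁ : SimpliciallyOrthogonal f (L.obj Y) := by
      -- `L Y` need not be fibrant, whereas local objects are; the hypothesis is applied to a
      -- fibrant replacement.
      obtain ⟨X, g, hX, hg⟩ := exists_fibrant_weakEquivalence (L.obj Y)
      exact (simpliciallyOrthogonal_iff_of_weakEquivalence f g hg).2
        (hf X ⟨hX, Y, .symm _ _ (.rel _ _ ⟨g, hg⟩)⟩)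
    have h₂ : ∀ D : M, SimpliciallyOrthogonal (ℓ.app D) (L.obj Y) := fun D =>
      hL.simpliciallyOrthogonal _ (hL.map_unit_mem D) (hL.unit_obj_mem Y)
    have e : SSet.mapπ₀ (hammockPrecomp (weakEquivalences M) (ℓ.app A) (L.obj Y)) ∘
        SSet.mapπ₀ (hammockPrecomp (weakEquivalences M) (L.map f) (L.obj Y)) =
        SSet.mapπ₀ (hammockPrecomp (weakEquivalences M) f (L.obj Y)) ∘
          SSet.mapπ₀ (hammockPrecomp (weakEquivalences M) (ℓ.app B) (L.obj Y)) := by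
      funext x
      have h := ℓ.naturality f
      dsimp only [Functor.id_obj, Functor.id_map] at h
      rw [Function.comp_apply, Function.comp_apply, ← SSet.mapπ₀_comp_apply,
        ← SSet.mapπ₀_comp_apply, ← hammockPrecomp_comp, ← hammockPrecomp_comp, h]
    refine (Function.Bijective.of_comp_iff' (h₂ A).bijective_mapπ₀ _).1 ?_
    exact e ▸ h₁.bijective_mapπ₀.comp (h₂ B).bijective_mapπ₀
  have := isIso_Q_map_of_hammockPrecomp (W := weakEquivalences M) (L.map f) (h A).2 (h B).1
  have := weakEquivalence_of_isIso_Q (L.map f)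
  rwa [weakEquivalence_iff] at this

/-- The unit `ℓ_X` is itself an `L`-equivalence, so it is orthogonal to `X` by hypothesis and to `L
X` by locality. The Yoneda argument makes it a weak equivalence. -/
lemma mem_localObjects_of_orthogonal (hL : IsHomotopyIdempotent L ℓ) {X : M}
    (hX : orthogonalObjects (localEquivalences L) X) : localObjects L X := by
  have h := hX.2 (ℓ.app X) (hL.map_unit_mem X)
  have h' : SimpliciallyOrthogonal (ℓ.app X) (L.obj X) :=
    hL.simpliciallyOrthogonal _ (hL.map_unit_mem X) (hL.unit_obj_mem X)
  have := isIso_Q_map_of_hammockPrecomp (W := weakEquivalences M) (ℓ.app X)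
    h.bijective_mapπ₀.2 h'.bijective_mapπ₀.1
  have := weakEquivalence_of_isIso_Q (ℓ.app X)
  rw [weakEquivalence_iff] at this
  exact ⟨hX.1, X, .rel _ _ ⟨ℓ.app X, this⟩⟩

end IsHomotopyIdempotent

end

theorem proposition5p3 {M : Type u} [Category.{v} M] [ModelCategory M]
    (L : M ⥤ M) (ℓ : 𝟭 M ⟶ L) (hL : IsHomotopyIdempotent L ℓ) :
    localEquivalences L = orthogonalMorphisms (localObjects L) ∧
      localObjects L = orthogonalObjects (localEquivalences L) := by
  refine ⟨?_, ?_⟩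
  · ext A B f
    refine ⟨?_, hL.mem_localEquivalences_of_orthogonal f⟩
    rintro hf X ⟨_, Y, hY⟩
    exact hL.simpliciallyOrthogonal f hf (hL.unit_mem_of_weaklyEquivalent hY)
  · ext X
    refine ⟨?_, hL.mem_localObjects_of_orthogonal⟩
    rintro ⟨hX, Y, hY⟩
    exact ⟨hX, fun A B f hf =>
      hL.simpliciallyOrthogonal f hf (hL.unit_mem_of_weaklyEquivalent hY)⟩
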